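/- Let $r:\{0,1,2,\dots\}\to\{1,2,\dots\}$ satisfy $r(0)=1$ and $r(m)\le r(m+1)\le r(m)+1$ for all $m\ge 0$. Candidates $1,2,\dots$ with i.i.d. $\mathrm{Exp}(1)$ values $X_1,X_2,\dots$ are examined one after another. When $m\ge 0$ candidates have been accepted so far, the next one is accepted if and only if her value exceeds the threshold $Y_m$, the $r(m)$-th largest of the $m$ accepted values, with $Y_m:=0$ if $r(m)=m+1$. Let $M_n$ be the number of candidates accepted among the first $n$. For $k\ge 1$ let $\delta_k:=1$ if $r(k)=r(k-1)$ and $\delta_k:=0$ otherwise, and for $m\ge 0$ let $$y_m:=\sum_{k=1}^m\frac{\delta_k}{r(k)},\qquad \lambda_m:=\sum_{k=0}^{m-1}e^{y_k}.$$ Let $E_k:=r(k)\,(Y_k-Y_{k-1})$ for $k\ge 1$. Suppose that $\sum_{m=1}^\infty r(m)^{-2}<\infty$. Then the variables $E_k$ with $\delta_k=1$ are i.i.d. with distribution $\mathrm{Exp}(1)$; almost surely $Y_m=\sum_{k=1}^m\frac{\delta_k}{r(k)}E_k$ for all $m\ge0$; the partial sums of the series $$Z:=\sum_{k=1}^\infty\frac{\delta_k}{r(k)}(E_k-1)$$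 converge almost surely to a finite random variable $Z$; and $$\frac{\lambda_{M_n}}{n}\to e^{-Z}\quad\text{almost surely as } n\to\infty.$$ -/

import Mathlib

open MeasureTheory ProbabilityTheory Filter Topology

noncomputable section

namespace Hiring

/-- A rank function: `r 0 = 1` and `r m ≤ r (m + 1) ≤ r m + 1`. -/
structure IsRankFunction (r : ℕ → ℕ) : Prop where
  zero : r 0 = 1
  le_succ : ∀ m, r m ≤ r (m + 1)
  succ_le : ∀ m, r (m + 1) ≤ r m + 1

/-- The `k`-th largest element (`k ≥ 1`) of a finite multiset of reals, and `0` if the multiset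
has fewer than `k` elements. -/
def kthLargest (A : Multiset ℝ) (k : ℕ) : ℝ :=
  (A.sort (fun a b => b ≤ a)).getD (k - 1) 0

/-- The threshold when the set of accepted candidates is `s`: with `m` elements in `s`, the
`r m`-th largest of the accepted values, or `0` if `r m = m + 1`. -/
def threshold (r : ℕ → ℕ) (x : ℕ → ℝ) (s : Finset ℕ) : ℝ :=
  kthLargest (s.val.map x) (r s.card)

/-- The set of accepted candidates among the first `n` candidates. The candidates are numbered
from `0`, so that `x 0, …, x (n - 1)` are the values of the first `n` candidates. The next
candidate is accepted iff its value exceeds the current threshold. -/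
def hired (r : ℕ → ℕ) (x : ℕ → ℝ) : ℕ → Finset ℕ
  | 0 => ∅
  | n + 1 =>
      if threshold r x (hired r x n) < x n then insert n (hired r x n) else hired r x n

/-- `M_n`: the number of accepted candidates among the first `n`. -/
def numHired (r : ℕ → ℕ) (x : ℕ → ℝ) (n : ℕ) : ℕ := (hired r x n).card

/-- `N_m`: the number of candidates examined until `m` are accepted. -/
def hireTime (r : ℕ → ℕ) (x : ℕ → ℝ) (m : ℕ) : ℕ := sInf {n | m ≤ numHired r x n}

/-- `Y_m`: the threshold in force once `m` candidates have been accepted. -/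
def Y (r : ℕ → ℕ) (x : ℕ → ℝ) (m : ℕ) : ℝ := threshold r x (hired r x (hireTime r x m))

/-- `δ_k`, for `k ≥ 1`: the indicator of `r k = r (k - 1)`. -/
def delta (r : ℕ → ℕ) (k : ℕ) : ℝ := if r k = r (k - 1) then 1 else 0

/-- `y_m = ∑_{k=1}^m δ_k / r(k)`. -/
def y (r : ℕ → ℕ) (m : ℕ) : ℝ := ∑ k ∈ Finset.Icc 1 m, delta r k / (r k : ℝ)

/-- `λ_m = ∑_{k=0}^{m-1} exp(y_k)`. -/
def lam (r : ℕ → ℕ) (m : ℕ) : ℝ := ∑ k ∈ Finset.range m, Real.exp (y r k)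

/-- `E_k = r(k) (Y_k - Y_{k-1})`, for `k ≥ 1`; only indices with `δ_k = 1` matter below. -/
def E (r : ℕ → ℕ) (x : ℕ → ℝ) (k : ℕ) : ℝ := (r k : ℝ) * (Y r x k - Y r x (k - 1))

end Hiring

end

/-! The exponential law has no memory. The `(m+1)`-th accepted value exceeds `Y_m` by an amount `gap
m`, and these gaps are i.i.d. `Exp(1)` (`map_gap`). After `m` acceptances the excesses over `Y_m` of
the `r m - 1` accepted values above it are again i.i.d. `Exp(1)`; the next acceptance adds one more.
If the rank stays the same, the smallest of these `r m` excesses is the increment of the threshold,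
which is `Exp(1)` divided by `r m`, and the remaining excesses, measured from the new threshold, are
fresh and independent of it (`map_min_removeMin`). If the rank grows, the threshold does not move.
`exists_split` is the pathwise form of this recursion, and `expSeq_innov_state` gives the joint law
of the innovations. Hence `Y_m - y_m` is a sum of centred independent terms with variances at most a
constant times `1 / r(m)^2`, and it converges almost surely to `Z`.

Given the past, a candidate facing threshold `t` is accepted with probability `exp (-t)`, so `1 -
exp t * 1{accepted}` has conditional mean zero, and `n - ∑_{m < M_n} exp(Y_m)` is a martingale. Its
increments divided by the predictable `λ_{M_n + 1}` have a convergent sum: the second moments are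
controlled by `∑ (exp(Y_m) / λ_{m+1})^2`, where `exp(Y_m)` is comparable to `exp(y_m)` and `exp(y_m)
/ λ_{m+1} = O(1 / r m)` (`exp_y_div_lam_le`). A truncation at a level `C` makes the bound
deterministic; almost every path is untouched once `C` is large. Kronecker's lemma gives `(n - ∑_{m
< M_n} exp(Y_m)) / λ_{M_n + 1} → 0`, while weighted averaging gives `∑_{k < m} exp(Y_k) / λ_m → exp
Z`. Since `λ_m / λ_{m+1} → 1`, it follows that `n / λ_{M_n} → exp Z`. -/

noncomputable section

namespace Hiring

/-! ### Order statistics of finite multisets. -/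

section KthLargest

lemma kthLargest_zero_or_mem (A : Multiset ℝ) (k : ℕ) :
    kthLargest A k = 0 ∨ kthLargest A k ∈ A := by
  unfold kthLargest
  by_cases h : k - 1 < (A.sort (fun a b => b ≤ a)).length
  · right
    rw [List.getD_eq_getElem _ _ h]
    exact (Multiset.mem_sort (r := fun a b : ℝ => b ≤ a)).1 (List.getElem_mem h)
  · left
    exact List.getD_eq_default _ _ (not_lt.1 h)

lemma sort_add {L U : Multiset ℝ} (h : ∀ u ∈ U, ∀ l ∈ L, l ≤ u) :
    (L + U).sort (fun a b => b ≤ a) =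
      U.sort (fun a b => b ≤ a) ++ L.sort (fun a b => b ≤ a) := by
  have hpw : (U.sort (fun a b => b ≤ a) ++ L.sort (fun a b => b ≤ a)).Pairwise
      (fun a b : ℝ => b ≤ a) := by
    rw [List.pairwise_append]
    refine ⟨Multiset.pairwise_sort _ _, Multiset.pairwise_sort _ _, fun a ha b hb => ?_⟩
    exact h a ((Multiset.mem_sort _).1 ha) b ((Multiset.mem_sort _).1 hb)
  refine List.Perm.eq_of_pairwise (le := fun a b : ℝ => b ≤ a)
    (fun a b _ _ h1 h2 => le_antisymm h2 h1) (Multiset.pairwise_sort _ _) hpw ?_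
  rw [← Multiset.coe_eq_coe, Multiset.sort_eq, ← Multiset.coe_add, Multiset.sort_eq,
    Multiset.sort_eq, add_comm]

/-- `U` holds the `k - 1` largest values and `t` heads the rest. The alternative `L = 0`, `t = 0` is
the default value of `kthLargest`, met while `r m = m + 1`. -/
lemma kthLargest_add {L U : Multiset ℝ} {t : ℝ} {k : ℕ} (hk : k = U.card + 1) (hU : ∀ u ∈ U, t ≤ u) (hL : ∀ l ∈ L, l ≤ t)
    (ht : t ∈ L ∨ (L = 0 ∧ t = 0)) : kthLargest (L + U) k = t := by
  subst hk
  unfold kthLargest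
  rw [sort_add fun u hu l hl => (hL l hl).trans (hU u hu),
    List.getD_append_right _ _ _ _ (by simp)]
  simp only [add_tsub_cancel_right, Multiset.length_sort, tsub_self]
  rcases ht with ht | ⟨rfl, rfl⟩
  · have hs : L = t ::ₘ L.erase t := (Multiset.cons_erase ht).symm
    rw [hs, Multiset.sort_cons]
    · simp
    · exact fun b hb => hL b (Multiset.mem_of_mem_erase hb)
  · simp

lemma lt_getElem_iff_lt_countP {l : List ℝ} (hl : l.Pairwise (fun a b => b ≤ a)) (t : ℝ) {k : ℕ}
    (hk : k < l.length) : t < l[k] ↔ k < l.countP (fun a => decide (t < a)) := by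
  induction l generalizing k with
  | nil => simp at hk
  | cons a l ih =>
    rw [List.pairwise_cons] at hl
    rw [List.countP_cons]
    rcases k with _ | k
    · by_cases hta : t < a
      · simp [hta]
      · simp only [List.getElem_cons_zero, hta, decide_false, Bool.false_eq_true, if_false,
          false_iff, not_lt, add_zero, Nat.le_zero, List.countP_eq_zero, decide_eq_true_eq]
        exact fun b hb => (hl.1 b hb).trans (not_lt.1 hta)
    · have hk' : k < l.length := by simpa using hk
      rw [List.getElem_cons_succ, ih hl.2 hk']
      by_cases hta : t < a
      · simp [hta]
      · have h0 : l.countP (fun a => decide (t < a)) = 0 := by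
          simp only [List.countP_eq_zero, decide_eq_true_eq, not_lt]
          exact fun b hb => (hl.1 b hb).trans (not_lt.1 hta)
        simp [hta, h0]

/-- Counting the entries above a level avoids sorting; this is how thresholds are shown to be
measurable. -/
lemma lt_kthLargest_iff {A : Multiset ℝ} {k : ℕ} (hk : 1 ≤ k) (hkA : k ≤ A.card) (t : ℝ) :
    t < kthLargest A k ↔ k ≤ A.countP (fun a => t < a) := by
  unfold kthLargest
  have hlen : k - 1 < (A.sort (fun a b => b ≤ a)).length := by
    rw [Multiset.length_sort]; omega
  rw [List.getD_eq_getElem _ _ hlen,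
    lt_getElem_iff_lt_countP (Multiset.pairwise_sort _ _)]
  have : (A.sort (fun a b => b ≤ a)).countP (fun a => decide (t < a))
      = A.countP (fun a => t < a) := by
    conv_rhs => rw [← Multiset.sort_eq A (fun a b => b ≤ a)]
    rw [Multiset.coe_countP]
  rw [this]
  omega

lemma kthLargest_of_card_lt {A : Multiset ℝ} {k : ℕ} (h : A.card < k) : kthLargest A k = 0 := by
  unfold kthLargest
  exact List.getD_eq_default _ _ (by rw [Multiset.length_sort]; omega)

end KthLargest

/-! ### Growth of the rank function. -/

section Rank

variable {r : ℕ → ℕ}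

lemma IsRankFunction.pos (hr : IsRankFunction r) (m : ℕ) : 1 ≤ r m := by
  induction m with
  | zero => exact hr.zero.ge
  | succ m ih => exact ih.trans (hr.le_succ m)

lemma IsRankFunction.le (hr : IsRankFunction r) (m : ℕ) : r m ≤ m + 1 := by
  induction m with
  | zero => exact hr.zero.le
  | succ m ih => exact (hr.succ_le m).trans (by omega)

lemma IsRankFunction.mono (hr : IsRankFunction r) : Monotone r :=
  monotone_nat_of_le_succ hr.le_succ

lemma IsRankFunction.le_add (hr : IsRankFunction r) (m d : ℕ) : r (m + d) ≤ r m + d := by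
  induction d with
  | zero => simp
  | succ d ih => exact (hr.succ_le (m + d)).trans (by omega)

end Rank

/-! ### Pathwise dynamics of the hiring process. -/

section Paths

variable (r : ℕ → ℕ) (x : ℕ → ℝ)

/-- The threshold in force when candidate `n` is examined. -/
def thr (n : ℕ) : ℝ := threshold r x (hired r x n)

lemma hired_succ (n : ℕ) :
    hired r x (n + 1) = if thr r x n < x n then insert n (hired r x n) else hired r x n := rfl

lemma hired_subset_range (n : ℕ) : hired r x n ⊆ Finset.range n := by
  induction n with
  | zero => simp [hired]
  | succ n ih =>
    have h : Finset.range n ⊆ Finset.range (n + 1) := Finset.range_mono n.le_succ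
    rw [hired_succ]
    split_ifs
    · exact Finset.insert_subset (by simp) (ih.trans h)
    · exact ih.trans h

lemma notMem_hired (n : ℕ) : n ∉ hired r x n := fun h => by
  simpa using hired_subset_range r x n h

lemma hired_mono : Monotone (hired r x) := by
  refine monotone_nat_of_le_succ fun n => ?_
  rw [hired_succ]
  split_ifs
  · exact Finset.subset_insert _ _
  · exact le_rfl

lemma numHired_succ (n : ℕ) :
    numHired r x (n + 1) = numHired r x n + if thr r x n < x n then 1 else 0 := by
  unfold numHired
  rw [hired_succ]
  split_ifs
  · rw [Finset.card_insert_of_notMem (notMem_hired r x n)]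
  · rfl

lemma numHired_zero : numHired r x 0 = 0 := rfl

lemma numHired_mono : Monotone (numHired r x) :=
  fun _ _ h => Finset.card_le_card (hired_mono r x h)

lemma hired_eq_of_numHired_eq {n n' : ℕ} (h : numHired r x n = numHired r x n') :
    hired r x n = hired r x n' := by
  rcases le_total n n' with hn | hn
  · exact Finset.eq_of_subset_of_card_le (hired_mono r x hn) h.ge
  · exact (Finset.eq_of_subset_of_card_le (hired_mono r x hn) h.le).symm

/-- A threshold is `0` or an accepted value, and acceptance requires a value strictly above the
threshold. Nonnegativity is what memorylessness needs later. -/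
lemma thr_nonneg_and_hired_pos (n : ℕ) : 0 ≤ thr r x n ∧ ∀ i ∈ hired r x n, 0 < x i := by
  have key : ∀ n, (∀ i ∈ hired r x n, 0 < x i) → 0 ≤ thr r x n := by
    intro n h
    rcases kthLargest_zero_or_mem ((hired r x n).val.map x) (r (hired r x n).card) with h0 | h0
    · exact h0.ge
    · obtain ⟨i, hi, hxi⟩ := Multiset.mem_map.1 h0
      exact (h i hi).le.trans_eq hxi
  have h2 : ∀ i ∈ hired r x n, 0 < x i := by
    induction n with
    | zero => simp [hired]
    | succ n ih =>
      rw [hired_succ]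
      split_ifs with hlt
      · intro i hi
        rcases Finset.mem_insert.1 hi with rfl | hi
        · exact (key i ih).trans_lt hlt
        · exact ih i hi
      · exact ih
  exact ⟨key n h2, h2⟩

lemma thr_nonneg (n : ℕ) : 0 ≤ thr r x n := (thr_nonneg_and_hired_pos r x n).1

variable {r x}

/-- Predictability: what happens before candidate `n` is examined depends only on earlier values. -/
lemma hired_congr {x' : ℕ → ℝ} {n : ℕ} (h : ∀ i < n, x i = x' i) :
    hired r x n = hired r x' n ∧ thr r x n = thr r x' n := by
  have key : ∀ n, (∀ i < n, x i = x' i) → hired r x n = hired r x' n → thr r x n = thr r x' n := by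
    intro n h h1
    unfold thr threshold
    rw [h1]
    congr 1
    refine Multiset.map_congr rfl fun i hi => h i ?_
    simpa using hired_subset_range r x' n hi
  have h1 : hired r x n = hired r x' n := by
    induction n with
    | zero => rfl
    | succ n ih =>
      have ih' := ih fun i hi => h i (by omega)
      rw [hired_succ, hired_succ, key n (fun i hi => h i (by omega)) ih', ih', h n (by omega)]
  exact ⟨h1, key n h h1⟩

lemma numHired_congr {x' : ℕ → ℝ} {n : ℕ} (h : ∀ i < n, x i = x' i) :
    numHired r x n = numHired r x' n := by
  unfold numHired; rw [(hired_congr h).1]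

lemma exists_numHired_eq (hM : Tendsto (numHired r x) atTop atTop) (m : ℕ) :
    ∃ n, numHired r x n = m ∧ thr r x n < x n := by
  obtain ⟨n, hn⟩ : ∃ n, m < numHired r x n := (hM.eventually_gt_atTop m).exists
  have hex : ∃ n, m < numHired r x n := ⟨n, hn⟩
  obtain ⟨N, hN, hN'⟩ : ∃ N, m < numHired r x N ∧ ∀ k < N, numHired r x k ≤ m :=
    ⟨Nat.find hex, Nat.find_spec hex, fun k hk => not_lt.1 (Nat.find_min hex hk)⟩
  obtain ⟨k, hk⟩ : ∃ k, N = k + 1 := Nat.exists_eq_succ_of_ne_zero fun h0 => by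
    rw [h0, numHired_zero] at hN; omega
  have h1 := hN' k (by omega)
  rw [hk, numHired_succ] at hN
  refine ⟨k, ?_⟩
  split_ifs at hN with hlt
  · exact ⟨by omega, hlt⟩
  · omega

lemma numHired_hireTime (hM : Tendsto (numHired r x) atTop atTop) (m : ℕ) :
    numHired r x (hireTime r x m) = m := by
  obtain ⟨n, hn, -⟩ := exists_numHired_eq hM m
  have hne : {n | m ≤ numHired r x n}.Nonempty := ⟨n, hn.ge⟩
  refine le_antisymm ?_ (Nat.sInf_mem hne)
  rw [← hn]
  exact numHired_mono r x (Nat.sInf_le (by simp))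

/-- Along one path the accepted sets are nested, so their cardinality determines them; candidate
time and acceptance time see the same threshold. -/
lemma Y_numHired (hM : Tendsto (numHired r x) atTop atTop) (n : ℕ) :
    Y r x (numHired r x n) = thr r x n := by
  unfold Y thr
  rw [hired_eq_of_numHired_eq r x (numHired_hireTime hM _)]

/-- Change of clock from candidates to acceptances. -/
lemma sum_hired (hM : Tendsto (numHired r x) atTop atTop) (f : ℕ → ℝ → ℝ) (n : ℕ) :
    ∑ i ∈ Finset.range n, (if thr r x i < x i then f (numHired r x i) (thr r x i) else 0)
      = ∑ m ∈ Finset.range (numHired r x n), f m (Y r x m) := by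
  induction n with
  | zero => simp [numHired_zero]
  | succ n ih =>
    rw [Finset.sum_range_succ, ih, numHired_succ]
    split_ifs
    · rw [Finset.sum_range_succ, Y_numHired hM]
    · simp

variable (r x)

/-- The excess of the `(m + 1)`-th accepted value over the threshold `Y_m`, provided the
acceptance occurs among the first `n` candidates, and `0` otherwise. -/
def gapUpTo (n m : ℕ) : ℝ :=
  ∑ i ∈ Finset.range n, if numHired r x i = m ∧ thr r x i < x i then x i - thr r x i else 0

/-- The excess of the `(m + 1)`-th accepted value over the threshold `Y_m`. -/
def gap (m : ℕ) : ℝ := gapUpTo r x (hireTime r x (m + 1)) m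

variable {r x}

lemma gapUpTo_of_le {n m : ℕ} (h : numHired r x n ≤ m) : gapUpTo r x n m = 0 := by
  refine Finset.sum_eq_zero fun i hi => if_neg fun hc => ?_
  have h1 : numHired r x (i + 1) ≤ numHired r x n :=
    numHired_mono r x (Finset.mem_range.1 hi)
  rw [numHired_succ, if_pos hc.2] at h1
  omega

lemma gapUpTo_succ_of_lt {n m : ℕ} (h : m < numHired r x n) :
    gapUpTo r x (n + 1) m = gapUpTo r x n m := by
  unfold gapUpTo
  rw [Finset.sum_range_succ, if_neg (by omega), add_zero]

lemma gapUpTo_succ_self {n : ℕ} (h : thr r x n < x n) :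
    gapUpTo r x (n + 1) (numHired r x n) = x n - thr r x n := by
  have := gapUpTo_of_le (r := r) (x := x) (le_refl (numHired r x n))
  unfold gapUpTo at this ⊢
  rw [Finset.sum_range_succ, this, if_pos ⟨rfl, h⟩, zero_add]

lemma gapUpTo_eq_gap (hM : Tendsto (numHired r x) atTop atTop) {n m : ℕ}
    (h : m < numHired r x n) : gapUpTo r x n m = gap r x m := by
  have hle : hireTime r x (m + 1) ≤ n := Nat.sInf_le h
  have h2 : m < numHired r x (hireTime r x (m + 1)) := by rw [numHired_hireTime hM]; omega
  unfold gap
  clear h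
  induction n, hle using Nat.le_induction with
  | base => rfl
  | succ n hn ih =>
    rw [gapUpTo_succ_of_lt (h2.trans_le (numHired_mono r x hn)), ih]

lemma gap_eq (hM : Tendsto (numHired r x) atTop atTop) {n : ℕ} (h : thr r x n < x n) :
    gap r x (numHired r x n) = x n - thr r x n := by
  rw [← gapUpTo_eq_gap hM (n := n + 1) (by rw [numHired_succ, if_pos h]; omega),
    gapUpTo_succ_self h]

end Paths

/-! ### Excesses over the threshold and the recursion for `Y`. -/

section State

/-- The first index at which `u 0, …, u (q - 1)` attain their minimum. -/
def firstArgmin : ℕ → (ℕ → ℝ) → ℕ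
  | 0, _ => 0
  | q + 1, u => if u q < u (firstArgmin q u) then q else firstArgmin q u

lemma firstArgmin_lt {q : ℕ} (hq : 1 ≤ q) (u : ℕ → ℝ) : firstArgmin q u < q := by
  induction q, hq using Nat.le_induction with
  | base => simp [firstArgmin]
  | succ q hq ih =>
    rw [firstArgmin]; split_ifs <;> omega

lemma firstArgmin_spec (q : ℕ) (u : ℕ → ℝ) :
    (∀ j < firstArgmin q u, u (firstArgmin q u) < u j) ∧
      ∀ j < q, u (firstArgmin q u) ≤ u j := by
  induction q with
  | zero => simp [firstArgmin]
  | succ q ih =>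
    rw [firstArgmin]
    split_ifs with h
    · refine ⟨fun j hj => h.trans_le (ih.2 j hj), fun j hj => ?_⟩
      rcases Nat.lt_succ_iff_lt_or_eq.1 hj with hj | rfl
      · exact h.le.trans (ih.2 j hj)
      · exact le_rfl
    · refine ⟨ih.1, fun j hj => ?_⟩
      rcases Nat.lt_succ_iff_lt_or_eq.1 hj with hj | rfl
      · exact ih.2 j hj
      · exact not_lt.1 h

/-- Ties go to the smallest index: comparisons are strict before `J` and weak after it. -/
lemma firstArgmin_eq_iff {q : ℕ} (u : ℕ → ℝ) {J : ℕ} (hJ : J < q) :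
    firstArgmin q u = J ↔ (∀ j < J, u J < u j) ∧ ∀ j < q, u J ≤ u j := by
  refine ⟨fun h => h ▸ firstArgmin_spec q u, fun h => ?_⟩
  have hs := firstArgmin_spec q u
  have hlt := firstArgmin_lt (by omega : 1 ≤ q) u
  rcases lt_trichotomy (firstArgmin q u) J with h1 | h1 | h1
  · exact absurd (h.1 _ h1) (not_lt.2 (hs.2 J hJ))
  · exact h1
  · exact absurd (hs.1 _ h1) (not_lt.2 (h.2 _ hlt))

/-- The increasing enumeration of the natural numbers other than `J`. -/
def skip (J j : ℕ) : ℕ := if j < J then j else j + 1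

/-- Delete the smallest of the first `q` entries and subtract it from the remaining `q - 1`. -/
def removeMin (q : ℕ) (u : ℕ → ℝ) (j : ℕ) : ℝ :=
  u (skip (firstArgmin q u) j) - if j + 1 < q then u (firstArgmin q u) else 0

/-- The excesses over the threshold: the first `r m - 1` entries belong to the accepted candidates
above the threshold `Y_m`, the others to the future acceptances. -/
def state (r : ℕ → ℕ) (u : ℕ → ℝ) : ℕ → ℕ → ℝ
  | 0 => u
  | m + 1 => if r (m + 1) = r m then removeMin (r m) (state r u m) else state r u m

/-- `E_{m + 1}` in terms of the excesses. -/
def innov (r : ℕ → ℕ) (u : ℕ → ℝ) (m : ℕ) : ℝ :=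
  if r (m + 1) = r m then r m * state r u m (firstArgmin (r m) (state r u m)) else 0

lemma map_range_eq_cons_skip {α : Type*} (u : ℕ → α) {J q : ℕ} (hJ : J < q) :
    (Multiset.range q).map u = u J ::ₘ (Multiset.range (q - 1)).map (fun j => u (skip J j)) := by
  obtain ⟨q, rfl⟩ : ∃ p, q = p + 1 := ⟨q - 1, by omega⟩
  induction q with
  | zero => obtain rfl : J = 0 := by omega
            simp
  | succ q ih =>
    rcases Nat.lt_succ_iff_lt_or_eq.1 hJ with h | rfl
    · rw [Multiset.range_succ, Multiset.map_cons, ih h, Nat.add_sub_cancel, Nat.add_sub_cancel,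
        Multiset.range_succ q, Multiset.map_cons, Multiset.cons_swap]
      congr 3
      simp [skip]; omega
    · rw [Multiset.range_succ, Multiset.map_cons, Nat.add_sub_cancel]
      congr 1
      refine Multiset.map_congr rfl fun j hj => ?_
      rw [skip, if_pos (Multiset.mem_range.1 hj)]

variable {r : ℕ → ℕ} {x : ℕ → ℝ}

/-- Deleting a minimum shifts the untouched tail by one place; when the rank grows, the boundary `r
m - 1` moves instead. Either way the entry at the boundary is the gap of the next acceptance. -/
lemma state_tail (m j : ℕ) (hr : IsRankFunction r) (u : ℕ → ℝ) :
    state r u m (r m - 1 + j) = u (m + j) := by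
  induction m generalizing j with
  | zero => simp [state, hr.zero]
  | succ m ih =>
    rw [state]
    have h1 := hr.pos m
    split_ifs with h
    · have hJ := firstArgmin_lt h1 (state r u m)
      rw [removeMin, skip, if_neg (by omega), if_neg (by omega), sub_zero, h,
        show r m - 1 + j + 1 = r m - 1 + (j + 1) by omega, ih]
      congr 1; omega
    · have h2 := hr.succ_le m
      have h3 := hr.le_succ m
      rw [show r (m + 1) - 1 + j = r m - 1 + (j + 1) by omega, ih]
      congr 1; omega

/-- The accepted values after `m` acceptances, split at the threshold. -/
lemma exists_split (hr : IsRankFunction r) (hM : Tendsto (numHired r x) atTop atTop) (m : ℕ) :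
    (∀ j < r m - 1, 0 ≤ state r (gap r x) m j) ∧ ∃ L : Multiset ℝ,
      (hired r x (hireTime r x m)).val.map x =
        L + (Multiset.range (r m - 1)).map (fun j => Y r x m + state r (gap r x) m j) ∧
      (∀ l ∈ L, l ≤ Y r x m) ∧ (Y r x m ∈ L ∨ (L = 0 ∧ Y r x m = 0)) ∧
      (∀ k, k + 1 = m → Y r x (k + 1) = Y r x k + innov r (gap r x) k / r k) := by
  have hYdef : ∀ m, Y r x m = kthLargest ((hired r x (hireTime r x m)).val.map x) (r m) := by
    intro m
    have h := numHired_hireTime hM m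
    rw [numHired] at h
    rw [Y, threshold, h]
  induction m with
  | zero =>
    have h0 : hired r x (hireTime r x 0) = ∅ := by
      rw [← Finset.card_eq_zero]; exact numHired_hireTime hM 0
    refine ⟨by simp [hr.zero], 0, by simp [h0, hr.zero], by simp, Or.inr ⟨rfl, ?_⟩, by simp⟩
    rw [hYdef, h0]
    exact kthLargest_of_card_lt (by simp [hr.zero])
  | succ m ih =>
    obtain ⟨hpos, L, hL, hLle, hYL, -⟩ := ih
    obtain ⟨n, hn, hlt⟩ := exists_numHired_eq hM m
    have hYn : Y r x m = thr r x n := by rw [← hn, Y_numHired hM]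
    have hgap : gap r x m = x n - Y r x m := by rw [hYn, ← hn, gap_eq hM hlt]
    have hrm := hr.pos m
    -- The newcomer's excess sits at position `r m - 1`, so the first `r m` entries describe every
    -- accepted value above `Y_m` after this acceptance.
    have htail : state r (gap r x) m (r m - 1) = gap r x m := by
      simpa using state_tail m 0 hr (gap r x)
    have hpos' : ∀ j < r m, 0 ≤ state r (gap r x) m j := by
      intro j hj
      rcases Nat.lt_or_ge j (r m - 1) with h | h
      · exact hpos j h
      · rw [show j = r m - 1 by omega, htail, hgap, hYn]
        linarith
    have hV : (hired r x (hireTime r x (m + 1))).val.map x =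
        L + (Multiset.range (r m)).map (fun j => Y r x m + state r (gap r x) m j) := by
      have h1 : hired r x (hireTime r x (m + 1)) = insert n (hired r x n) := by
        have : hired r x (n + 1) = insert n (hired r x n) := by rw [hired_succ, if_pos hlt]
        rw [← this]
        refine hired_eq_of_numHired_eq r x ?_
        rw [numHired_hireTime hM, numHired_succ, if_pos hlt, hn]
      have h2 : hired r x (hireTime r x m) = hired r x n :=
        hired_eq_of_numHired_eq r x (by rw [numHired_hireTime hM, hn])
      rw [h2] at hL
      rw [h1, Finset.insert_val_of_notMem (notMem_hired r x n), Multiset.map_cons, hL]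
      obtain ⟨q, hq⟩ : ∃ q, r m = q + 1 := ⟨r m - 1, by omega⟩
      rw [hq] at htail ⊢
      rw [Nat.add_sub_cancel] at htail ⊢
      rw [Multiset.range_succ, Multiset.map_cons, htail, hgap, ← Multiset.add_cons]
      congr 2
      ring
    -- If the rank is unchanged, the smallest excess becomes the threshold and its owner joins `L`;
    -- otherwise the newcomer occupies the additional place above an unchanged threshold.
    by_cases hδ : r (m + 1) = r m
    · set u := state r (gap r x) m with hu
      set J := firstArgmin (r m) u with hJdef
      have hJ : J < r m := firstArgmin_lt hrm u
      have hst : state r (gap r x) (m + 1) = removeMin (r m) u := by rw [state, if_pos hδ]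
      have hmin := (firstArgmin_spec (r m) u).2
      have hVs : (hired r x (hireTime r x (m + 1))).val.map x =
          ((Y r x m + u J) ::ₘ L) + (Multiset.range (r (m + 1) - 1)).map
            (fun j => (Y r x m + u J) + state r (gap r x) (m + 1) j) := by
        rw [hV, map_range_eq_cons_skip _ hJ, Multiset.add_cons, Multiset.cons_add, hδ]
        congr 2
        refine Multiset.map_congr rfl fun j hj => ?_
        rw [hst, removeMin, if_pos (by have := Multiset.mem_range.1 hj; omega)]
        ring
      have hnn : ∀ j < r (m + 1) - 1, 0 ≤ state r (gap r x) (m + 1) j := by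
        intro j hj
        rw [hst, removeMin, if_pos (by omega), sub_nonneg]
        refine hmin _ ?_
        unfold skip; split_ifs <;> omega
      have hle : ∀ l ∈ (Y r x m + u J) ::ₘ L, l ≤ Y r x m + u J := by
        intro l hl
        rcases Multiset.mem_cons.1 hl with rfl | hl
        · exact le_rfl
        · linarith [hLle l hl, hpos' J hJ]
      have hY : Y r x (m + 1) = Y r x m + u J := by
        rw [hYdef (m + 1), hVs]
        have hcard : r (m + 1) = ((Multiset.range (r (m + 1) - 1)).map
            (fun j => (Y r x m + u J) + state r (gap r x) (m + 1) j)).card + 1 := by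
          rw [Multiset.card_map, Multiset.card_range]; omega
        refine kthLargest_add hcard ?_ hle (Or.inl (Multiset.mem_cons_self _ _))
        intro v hv
        obtain ⟨j, hj, rfl⟩ := Multiset.mem_map.1 hv
        linarith [hnn j (Multiset.mem_range.1 hj)]
      refine ⟨hnn, _, hY ▸ hVs, hY ▸ hle, Or.inl (hY ▸ Multiset.mem_cons_self _ _), ?_⟩
      rintro k hk
      obtain rfl : k = m := by omega
      rw [hY, innov, if_pos hδ, ← hu, ← hJdef, mul_div_cancel_left₀]
      exact_mod_cast (by omega : r k ≠ 0)
    · have hst : state r (gap r x) (m + 1) = state r (gap r x) m := by rw [state, if_neg hδ]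
      have hr1 : r (m + 1) - 1 = r m := by
        have h2 := hr.succ_le m
        have h3 := hr.le_succ m
        omega
      have hY : Y r x (m + 1) = Y r x m := by
        rw [hYdef (m + 1), hV]
        have hcard : r (m + 1) = ((Multiset.range (r m)).map
            (fun j => Y r x m + state r (gap r x) m j)).card + 1 := by
          rw [Multiset.card_map, Multiset.card_range]; omega
        refine kthLargest_add hcard ?_ hLle hYL
        intro v hv
        obtain ⟨j, hj, rfl⟩ := Multiset.mem_map.1 hv
        linarith [hpos' j (Multiset.mem_range.1 hj)]
      refine ⟨by rw [hr1, hst]; exact hpos', L, by rw [hr1, hst, hY, hV], by rwa [hY], by rwa [hY],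
        ?_⟩
      rintro k hk
      obtain rfl : k = m := by omega
      rw [hY, innov, if_neg hδ]
      simp

lemma Y_zero (hr : IsRankFunction r) (hM : Tendsto (numHired r x) atTop atTop) : Y r x 0 = 0 := by
  rw [← numHired_zero r x, Y_numHired hM]
  exact kthLargest_of_card_lt (by simp [hr.zero, hired])

lemma Y_succ (hr : IsRankFunction r) (hM : Tendsto (numHired r x) atTop atTop) (m : ℕ) :
    Y r x (m + 1) = Y r x m + innov r (gap r x) m / r m := by
  obtain ⟨-, L, -, -, -, h⟩ := exists_split hr hM (m + 1)
  exact h m rfl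

lemma E_succ (hr : IsRankFunction r) (hM : Tendsto (numHired r x) atTop atTop) (m : ℕ) :
    E r x (m + 1) = innov r (gap r x) m := by
  have h1 : (r m : ℝ) ≠ 0 := by exact_mod_cast (by have := hr.pos m; omega : r m ≠ 0)
  rw [E, Nat.add_sub_cancel, Y_succ hr hM, add_sub_cancel_left]
  by_cases h : r (m + 1) = r m
  · rw [h]; field_simp
  · simp [innov, h]

lemma Y_eq_sum (hr : IsRankFunction r) (hM : Tendsto (numHired r x) atTop atTop) (m : ℕ) :
    Y r x m = ∑ k ∈ Finset.Icc 1 m, delta r k / (r k : ℝ) * E r x k := by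
  induction m with
  | zero => simp [Y_zero hr hM]
  | succ m ih =>
    rw [Finset.sum_Icc_succ_top (by omega), ← ih, E_succ hr hM, Y_succ hr hM, delta,
      Nat.add_sub_cancel]
    by_cases h : r (m + 1) = r m
    · rw [if_pos h, h]; ring
    · simp [innov, h]

end State

/-! ### The exponential law: memorylessness and minima. -/

section Exponential

/-- The standard exponential distribution. -/
abbrev stdExp : Measure ℝ := expMeasure 1

instance : IsProbabilityMeasure stdExp := isProbabilityMeasure_expMeasure one_pos

lemma stdExp_eq : stdExp = volume.withDensity (exponentialPDF 1) := rfl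

instance : NullSingletonClass stdExp := by
  rw [stdExp_eq]; infer_instance

lemma measurable_exponentialPDF : Measurable (exponentialPDF 1) :=
  (measurable_exponentialPDFReal 1).ennreal_ofReal

lemma lintegral_stdExp {f : ℝ → ENNReal} (hf : Measurable f) :
    ∫⁻ s, f s ∂stdExp = ∫⁻ s, exponentialPDF 1 s * f s := by
  rw [stdExp_eq, lintegral_withDensity_eq_lintegral_mul _ measurable_exponentialPDF hf]
  rfl

lemma stdExp_Iic_zero : stdExp (Set.Iic 0) = 0 := by
  have h := cdf_expMeasure_eq one_pos 0
  rw [cdf_eq_real] at h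
  rw [← measureReal_eq_zero_iff]
  simpa using h

lemma ae_stdExp_pos : ∀ᵐ s ∂stdExp, 0 < s := by
  rw [ae_iff, ← stdExp_Iic_zero]
  congr 1
  ext
  simp

/-- The lack of memory. -/
lemma stdExp_memoryless {t : ℝ} (ht : 0 ≤ t) {B : Set ℝ} (hB : MeasurableSet B) :
    stdExp {s | t < s ∧ s - t ∈ B} = ENNReal.ofReal (Real.exp (-t)) * stdExp B := by
  have hm : MeasurableSet {s : ℝ | t < s ∧ s - t ∈ B} :=
    measurableSet_Ioi.inter ((measurable_id.sub_const t) hB)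
  have h1 : stdExp B = stdExp (Set.Ioi 0 ∩ B) := by
    refine measure_congr ?_
    filter_upwards [ae_stdExp_pos] with s hs
    exact propext ⟨fun h => ⟨hs, h⟩, fun h => h.2⟩
  have hg : Measurable fun s => exponentialPDF 1 s * (Set.Ioi 0 ∩ B).indicator 1 s :=
    measurable_exponentialPDF.mul (measurable_one.indicator (measurableSet_Ioi.inter hB))
  rw [h1, ← lintegral_indicator_one hm, ← lintegral_indicator_one (measurableSet_Ioi.inter hB),
    lintegral_stdExp (measurable_one.indicator hm),
    lintegral_stdExp (measurable_one.indicator (measurableSet_Ioi.inter hB)),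
    ← lintegral_const_mul _ hg,
    ← lintegral_add_right_eq_self _ t]
  refine lintegral_congr fun s => ?_
  by_cases hs : s ∈ Set.Ioi 0 ∩ B
  · have h2 : s + t ∈ {s : ℝ | t < s ∧ s - t ∈ B} := by
      have := hs.1.out
      exact ⟨by linarith, by simpa using hs.2⟩
    have h0 : 0 ≤ s := hs.1.out.le
    rw [Set.indicator_of_mem hs, Set.indicator_of_mem h2,
      exponentialPDF_of_nonneg (by linarith), exponentialPDF_of_nonneg h0]
    simp only [Pi.one_apply, mul_one, one_mul]
    rw [← ENNReal.ofReal_mul (Real.exp_pos _).le, ← Real.exp_add]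
    ring_nf
  · have h2 : s + t ∉ {s : ℝ | t < s ∧ s - t ∈ B} := fun h =>
      hs ⟨by have := h.1; simp only [Set.mem_Ioi]; linarith, by simpa using h.2⟩
    rw [Set.indicator_of_notMem hs, Set.indicator_of_notMem h2]
    simp

/-- The weak inequality occurs for entries after the first minimum, where ties are allowed. -/
lemma stdExp_memoryless' {t : ℝ} (ht : 0 ≤ t) {B : Set ℝ} (hB : MeasurableSet B) :
    stdExp {s | t ≤ s ∧ s - t ∈ B} = ENNReal.ofReal (Real.exp (-t)) * stdExp B := by
  rw [← stdExp_memoryless ht hB]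
  refine measure_congr ?_
  have : ∀ᵐ s ∂stdExp, s ≠ t := by
    rw [ae_iff]; simp
  filter_upwards [this] with s hs
  exact propext ⟨fun h => ⟨lt_of_le_of_ne h.1 hs.symm, h.2⟩, fun h => ⟨h.1.le, h.2⟩⟩

lemma stdExp_Ioi {t : ℝ} (ht : 0 ≤ t) :
    stdExp (Set.Ioi t) = ENNReal.ofReal (Real.exp (-t)) := by
  simpa [Set.Ioi] using stdExp_memoryless ht MeasurableSet.univ

/-- The minimum of `q` independent standard exponential variables, multiplied by `q`. -/
lemma mul_setLIntegral_stdExp {q : ℕ} (hq : 1 ≤ q) {B : Set ℝ} (hB : MeasurableSet B) :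
    q * ∫⁻ t in {t | q * t ∈ B}, ENNReal.ofReal (Real.exp (-t)) ^ (q - 1) ∂stdExp = stdExp B := by
  have hq0 : (0 : ℝ) < q := by exact_mod_cast hq
  have hm : MeasurableSet {t : ℝ | q * t ∈ B} := (measurable_const_mul (q : ℝ)) hB
  have hf : Measurable fun t : ℝ => ENNReal.ofReal (Real.exp (-t)) ^ (q - 1) := by fun_prop
  have hg : Measurable fun t => exponentialPDF 1 t * B.indicator 1 t :=
    measurable_exponentialPDF.mul (measurable_one.indicator hB)
  -- Substitution `s = q * t`: the density `exp (-t)` of one variable, times the probability `exp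
  -- (-t)^(q-1)` that the others exceed it, times `q`, is `q * exp (-q * t)`.
  have hscale : ∫⁻ s, exponentialPDF 1 s * B.indicator 1 s =
      q * ∫⁻ t, exponentialPDF 1 (q * t) * B.indicator 1 (q * t) := by
    conv_lhs => rw [← Real.smul_map_volume_mul_left hq0.ne']
    rw [lintegral_smul_measure, lintegral_map hg (measurable_const_mul (q : ℝ)), abs_of_pos hq0,
      ENNReal.ofReal_natCast, smul_eq_mul]
  rw [← lintegral_indicator hm, lintegral_stdExp (hf.indicator hm), ← lintegral_indicator_one hB,
    lintegral_stdExp (measurable_one.indicator hB), hscale]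
  congr 1
  refine lintegral_congr fun t => ?_
  by_cases ht : q * t ∈ B
  · rw [Set.indicator_of_mem (s := {t : ℝ | q * t ∈ B}) ht, Set.indicator_of_mem ht, Pi.one_apply,
      mul_one]
    rcases lt_or_ge t 0 with h0 | h0
    · rw [exponentialPDF_of_neg h0, exponentialPDF_of_neg (mul_neg_of_pos_of_neg hq0 h0), zero_mul]
    · rw [exponentialPDF_of_nonneg h0, exponentialPDF_of_nonneg (by positivity),
        ← ENNReal.ofReal_pow (Real.exp_pos _).le, ← ENNReal.ofReal_mul (by positivity),
        ← Real.exp_nat_mul, one_mul, one_mul, one_mul, one_mul, ← Real.exp_add]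
      congr 2
      rw [Nat.cast_sub hq]
      push_cast
      ring
  · rw [Set.indicator_of_notMem (s := {t : ℝ | q * t ∈ B}) ht, Set.indicator_of_notMem ht]
    simp

end Exponential

/-! ### Removing the minimum from an i.i.d. exponential sequence. -/

section Sequences

/-- The law of an independent sequence of standard exponential variables. -/
abbrev expSeq : Measure (ℕ → ℝ) := Measure.infinitePi fun _ => stdExp

/-- Any finite cylinder becomes an initial box after padding with `Set.univ`, so boxes of
arbitrarily large length suffice; callers choose `N` past the positions they alter. -/
lemma eq_infinitePi_of_range {ν : Measure ℝ} [IsProbabilityMeasure ν] {ρ : Measure (ℕ → ℝ)}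
    (h : ∀ T : ℕ → Set ℝ, (∀ i, MeasurableSet (T i)) → ∀ N₀, ∃ N, N₀ ≤ N ∧
      ρ {u | ∀ i < N, u i ∈ T i} = ∏ i ∈ Finset.range N, ν (T i)) :
    ρ = Measure.infinitePi fun _ => ν := by
  refine Measure.eq_infinitePi _ fun s T hT => ?_
  classical
  obtain ⟨N, hN, h1⟩ := h (fun i => if i ∈ s then T i else Set.univ)
    (fun i => by split_ifs; exacts [hT i, MeasurableSet.univ]) (s.sup id + 1)
  have hsN : s ⊆ Finset.range N := fun i hi => by
    have : i ≤ s.sup id := Finset.le_sup (f := id) hi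
    rw [Finset.mem_range]; omega
  have h2 : {u : ℕ → ℝ | ∀ i < N, u i ∈ if i ∈ s then T i else Set.univ} = Set.pi s T := by
    ext u
    simp only [Set.mem_ofPred_eq, Set.mem_pi, Finset.mem_coe]
    refine ⟨fun hu i hi => ?_, fun hu i _ => ?_⟩
    · simpa [hi] using hu i (Finset.mem_range.1 (hsN hi))
    · split_ifs with hi
      exacts [hu i hi, trivial]
  rw [← h2, h1, ← Finset.prod_subset hsN]
  · exact Finset.prod_congr rfl fun i hi => by rw [if_pos hi]
  · intro i _ hi
    simp [hi]

lemma measurableSet_forall_lt {T : ℕ → Set ℝ} (hT : ∀ i, MeasurableSet (T i)) (N : ℕ) :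
    MeasurableSet {u : ℕ → ℝ | ∀ i < N, u i ∈ T i} := by
  have : {u : ℕ → ℝ | ∀ i < N, u i ∈ T i} = Set.pi (Finset.range N) T := by
    ext; simp [Set.mem_pi]
  rw [this]
  exact MeasurableSet.pi (Finset.range N).countable_toSet fun i _ => hT i

/-- Insert the entry `t` at position `J`. -/
def insertAt (J : ℕ) (t : ℝ) (v : ℕ → ℝ) (i : ℕ) : ℝ :=
  if i < J then v i else if i = J then t else v (i - 1)

@[simp] lemma insertAt_self (J : ℕ) (t : ℝ) (v : ℕ → ℝ) : insertAt J t v J = t := by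
  simp [insertAt]

@[simp] lemma insertAt_skip (J : ℕ) (t : ℝ) (v : ℕ → ℝ) (j : ℕ) :
    insertAt J t v (skip J j) = v j := by
  unfold insertAt skip
  split_ifs <;> first | rfl | omega

lemma exists_skip_eq {J i : ℕ} (h : i ≠ J) : ∃ j, skip J j = i := by
  rcases Nat.lt_or_gt_of_ne h with h | h
  · exact ⟨i, if_pos h⟩
  · exact ⟨i - 1, by rw [skip, if_neg (by omega)]; omega⟩

@[fun_prop]
lemma measurable_insertAt (J : ℕ) :
    Measurable fun p : ℝ × (ℕ → ℝ) => insertAt J p.1 p.2 := by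
  refine measurable_pi_lambda _ fun i => ?_
  unfold insertAt
  split_ifs <;> fun_prop

lemma infinitePi_range (T : ℕ → Set ℝ) (hT : ∀ i, MeasurableSet (T i)) (N : ℕ) :
    expSeq {v | ∀ i < N, v i ∈ T i} = ∏ i ∈ Finset.range N, stdExp (T i) := by
  have : {v : ℕ → ℝ | ∀ i < N, v i ∈ T i} = Set.pi (Finset.range N) T := by
    ext; simp [Set.mem_pi]
  rw [this, Measure.infinitePi_pi _ fun i _ => hT i]

lemma map_insertAt (J : ℕ) :
    (stdExp.prod expSeq).map (fun p => insertAt J p.1 p.2) = expSeq := by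
  refine eq_infinitePi_of_range fun T hT N₀ => ⟨max N₀ (J + 1), le_max_left _ _, ?_⟩
  set N := max N₀ (J + 1) with hN
  have hJ : J < N := by omega
  rw [Measure.map_apply (by fun_prop) (measurableSet_forall_lt hT N)]
  have h1 : (fun p : ℝ × (ℕ → ℝ) => insertAt J p.1 p.2) ⁻¹' {u | ∀ i < N, u i ∈ T i} =
      T J ×ˢ {v | ∀ j < N - 1, v j ∈ T (skip J j)} := by
    ext ⟨t, v⟩
    simp only [Set.mem_preimage, Set.mem_ofPred_eq, Set.mem_prod]
    refine ⟨fun h => ⟨by simpa using h J hJ, fun j hj => ?_⟩, fun h i hi => ?_⟩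
    · simpa using h (skip J j) (by unfold skip; split_ifs <;> omega)
    · by_cases hiJ : i = J
      · subst hiJ; simpa using h.1
      · obtain ⟨j, rfl⟩ := exists_skip_eq hiJ
        rw [insertAt_skip]
        refine h.2 j ?_
        unfold skip at hi
        split_ifs at hi <;> omega
  rw [h1, Measure.prod_prod, infinitePi_range _ fun i => hT _]
  have h2 := congrArg Multiset.prod (map_range_eq_cons_skip (fun i => stdExp (T i)) hJ)
  rw [Multiset.prod_cons] at h2
  exact h2.symm

lemma measurable_eval {f : (ℕ → ℝ) → ℕ} (hf : Measurable f) :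
    Measurable fun u : ℕ → ℝ => u (f u) :=
  (measurable_from_prod_countable_right (f := fun p : ℕ × (ℕ → ℝ) => p.2 p.1)
    (fun n => measurable_pi_apply n)).comp (hf.prodMk measurable_id)

@[fun_prop]
lemma measurable_firstArgmin (q : ℕ) : Measurable (firstArgmin q) := by
  induction q with
  | zero => exact measurable_const
  | succ q ih =>
    exact Measurable.ite (measurableSet_lt (measurable_pi_apply q) (measurable_eval ih))
      measurable_const ih

@[fun_prop]
lemma measurable_removeMin (q : ℕ) : Measurable (removeMin q) := by
  refine measurable_pi_lambda _ fun j => ?_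
  refine Measurable.sub ?_ ?_
  · refine measurable_eval (f := fun u => skip (firstArgmin q u) j) ?_
    exact (measurable_of_countable fun J => skip J j).comp (measurable_firstArgmin q)
  · split_ifs
    · exact measurable_eval (measurable_firstArgmin q)
    · exact measurable_const

/-- Conditioning on the value of coordinate `J`. -/
lemma lintegral_expSeq_insertAt (J : ℕ) {A : Set (ℕ → ℝ)} (hA : MeasurableSet A) :
    expSeq A = ∫⁻ t, expSeq {v | insertAt J t v ∈ A} ∂stdExp := by
  conv_lhs => rw [← map_insertAt J]
  rw [Measure.map_apply (by fun_prop) hA, Measure.prod_apply ((measurable_insertAt J) hA)]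
  rfl

/-- The cylinder probabilities of the rescaled minimum and the remaining excesses. -/
lemma expSeq_removeMin_cylinder {q : ℕ} (hq : 1 ≤ q) {B : Set ℝ} (hB : MeasurableSet B)
    (T : ℕ → Set ℝ) (hT : ∀ i, MeasurableSet (T i)) {N : ℕ} (hN : q ≤ N) :
    expSeq {u | q * u (firstArgmin q u) ∈ B ∧ ∀ j < N, removeMin q u j ∈ T j} =
      stdExp B * ∏ j ∈ Finset.range N, stdExp (T j) := by
  set A := {u : ℕ → ℝ | q * u (firstArgmin q u) ∈ B ∧ ∀ j < N, removeMin q u j ∈ T j} with hA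
  have hAm : MeasurableSet A := by
    exact (((measurable_eval (measurable_firstArgmin q)).const_mul (q : ℝ)) hB).inter
      ((measurable_removeMin q) (measurableSet_forall_lt hT N))
  have hAJ : ∀ J, MeasurableSet (A ∩ {u | firstArgmin q u = J}) := fun J =>
    hAm.inter ((measurable_firstArgmin q) (measurableSet_singleton J))
  -- Split by the position `J` of the minimum; by `hterm` the `q` positions contribute equally,
  -- which supplies the factor `q` in `mul_setLIntegral_stdExp`.
  have hsplit : expSeq A = ∑ J ∈ Finset.range q, expSeq (A ∩ {u | firstArgmin q u = J}) := by
    rw [← measure_biUnion_finset _ fun J _ => hAJ J]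
    · congr 1
      ext u
      simp only [Set.mem_iUnion, Finset.mem_range, Set.mem_inter_iff, Set.mem_ofPred_eq]
      exact ⟨fun h => ⟨_, firstArgmin_lt hq u, h, rfl⟩, fun ⟨_, _, h, _⟩ => h⟩
    · intro J _ J' _ hne
      exact Set.disjoint_left.2 fun u h h' => hne (h.2.symm.trans h'.2)
  have hterm : ∀ J ∈ Finset.range q, expSeq (A ∩ {u | firstArgmin q u = J}) =
      (∫⁻ t in {t | q * t ∈ B}, ENNReal.ofReal (Real.exp (-t)) ^ (q - 1) ∂stdExp) *
        ∏ j ∈ Finset.range N, stdExp (T j) := by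
    intro J hJ
    have hJ := Finset.mem_range.1 hJ
    have hm : MeasurableSet {t : ℝ | q * t ∈ B} := (measurable_const_mul (q : ℝ)) hB
    rw [lintegral_expSeq_insertAt J (hAJ J), ← lintegral_mul_const _ (by fun_prop),
      ← lintegral_indicator hm]
    refine lintegral_congr_ae ?_
    filter_upwards [ae_stdExp_pos] with t ht
    -- Given the minimum `t` at position `J`, the event is a product condition on the other entries:
    -- the first `q - 1` must exceed `t` with excess in `T j`, and the tail is unshifted.
    let S : ℕ → Set ℝ := fun j => if j + 1 < q then
      (if j < J then {s | t < s ∧ s - t ∈ T j} else {s | t ≤ s ∧ s - t ∈ T j}) else T j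
    have hS : ∀ j, MeasurableSet (S j) := by
      intro j
      have h1 : MeasurableSet {s : ℝ | s - t ∈ T j} := (measurable_id.sub_const t) (hT j)
      simp only [S]
      split_ifs
      · exact measurableSet_Ioi.inter h1
      · exact measurableSet_Ici.inter h1
      · exact hT j
    have hset : {v | insertAt J t v ∈ A ∩ {u | firstArgmin q u = J}} =
        {v | q * t ∈ B ∧ ∀ j < N, v j ∈ S j} := by
      ext v
      have hiff := firstArgmin_eq_iff (insertAt J t v) hJ
      have hcond : ((∀ j < J, insertAt J t v J < insertAt J t v j) ∧
          ∀ j < q, insertAt J t v J ≤ insertAt J t v j) ↔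
          ∀ j, j + 1 < q → if j < J then t < v j else t ≤ v j := by
        rw [insertAt_self]
        constructor
        · rintro ⟨h1, h2⟩ j hj
          split_ifs with hjJ
          · have := h1 j hjJ
            rwa [insertAt, if_pos hjJ] at this
          · have := h2 (j + 1) hj
            rwa [insertAt, if_neg (by omega), if_neg (by omega)] at this
        · intro h
          refine ⟨fun j hj => ?_, fun j hj => ?_⟩
          · have := h j (by omega)
            rw [if_pos hj] at this
            rwa [insertAt, if_pos hj]
          · by_cases hjJ : j = J
            · rw [hjJ, insertAt_self]
            · obtain ⟨i, rfl⟩ := exists_skip_eq hjJ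
              rw [insertAt_skip]
              have := h i (by unfold skip at hj; split_ifs at hj <;> omega)
              split_ifs at this
              exacts [this.le, this]
      rw [hcond] at hiff
      simp only [hA, Set.mem_ofPred_eq, Set.mem_inter_iff]
      constructor
      · rintro ⟨⟨h1, h2⟩, h3⟩
        rw [h3, insertAt_self] at h1
        refine ⟨h1, fun j hj => ?_⟩
        have h4 := h2 j hj
        rw [removeMin, h3, insertAt_skip, insertAt_self] at h4
        have h5 := hiff.1 h3 j
        simp only [S]
        split_ifs with h6 h7
        · rw [if_pos h6] at h4
          rw [if_pos h7] at h5
          exact ⟨h5 h6, h4⟩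
        · rw [if_pos h6] at h4
          rw [if_neg h7] at h5
          exact ⟨h5 h6, h4⟩
        · simpa [h6] using h4
      · rintro ⟨h1, h2⟩
        have h3 : firstArgmin q (insertAt J t v) = J := by
          refine hiff.2 fun j hj => ?_
          have := h2 j (by omega)
          simp only [S, if_pos hj] at this
          split_ifs at this ⊢
          exacts [this.1, this.1]
        rw [h3, insertAt_self]
        refine ⟨⟨h1, fun j hj => ?_⟩, rfl⟩
        rw [removeMin, h3, insertAt_skip, insertAt_self]
        have h4 := h2 j hj
        simp only [S] at h4
        split_ifs at h4 ⊢
        · exact h4.2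
        · exact h4.2
        · simpa using h4
    rw [hset]
    by_cases hqt : q * t ∈ B
    · rw [Set.indicator_of_mem (s := {t : ℝ | q * t ∈ B}) hqt]
      simp only [hqt, true_and]
      rw [infinitePi_range S hS]
      have hval : ∀ j, stdExp (S j) =
          (if j + 1 < q then ENNReal.ofReal (Real.exp (-t)) else 1) * stdExp (T j) := by
        intro j
        simp only [S]
        split_ifs
        · exact stdExp_memoryless ht.le (hT j)
        · exact stdExp_memoryless' ht.le (hT j)
        · rw [one_mul]
      simp_rw [hval]
      rw [Finset.prod_mul_distrib]
      congr 1
      rw [Finset.prod_ite, Finset.prod_const, Finset.prod_const_one, mul_one]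
      congr 1
      have : (Finset.range N).filter (fun j => j + 1 < q) = Finset.range (q - 1) := by
        ext j; simp only [Finset.mem_filter, Finset.mem_range]; omega
      rw [this, Finset.card_range]
    · rw [Set.indicator_of_notMem (s := {t : ℝ | q * t ∈ B}) hqt]
      simp [hqt]
  rw [hsplit, Finset.sum_congr rfl hterm, Finset.sum_const, Finset.card_range, nsmul_eq_mul,
    ← mul_assoc, mul_setLIntegral_stdExp hq hB]

/-- The rescaled minimum of the first `q` entries and the remaining excesses are independent, and
the latter are again an independent exponential sequence. -/
lemma map_min_removeMin {q : ℕ} (hq : 1 ≤ q) :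
    expSeq.map (fun u => ((q : ℝ) * u (firstArgmin q u), removeMin q u)) = stdExp.prod expSeq := by
  have hm1 : Measurable fun u : ℕ → ℝ => ((q : ℝ) * u (firstArgmin q u), removeMin q u) :=
    ((measurable_eval (measurable_firstArgmin q)).const_mul (q : ℝ)).prodMk
      (measurable_removeMin q)
  have hm2 : Measurable fun u : ℕ → ℝ =>
      insertAt 0 ((q : ℝ) * u (firstArgmin q u)) (removeMin q u) :=
    (measurable_insertAt 0).comp hm1
  have hun : Measurable fun v : ℕ → ℝ => (v 0, fun j => v (j + 1)) := by fun_prop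
  have hid : ∀ p : ℝ × (ℕ → ℝ),
      ((insertAt 0 p.1 p.2 0, fun j => insertAt 0 p.1 p.2 (j + 1)) : ℝ × (ℕ → ℝ)) = p := by
    rintro ⟨t, v⟩
    simp [insertAt]
  -- The pair is encoded as one sequence with the rescaled minimum in front, so that the box
  -- criterion for product measures applies, and is decoded afterwards.
  have hcons : expSeq.map (fun u => insertAt 0 ((q : ℝ) * u (firstArgmin q u)) (removeMin q u)) =
      expSeq := by
    refine eq_infinitePi_of_range fun T hT N₀ => ⟨max N₀ q + 1, by omega, ?_⟩
    rw [Measure.map_apply hm2 (measurableSet_forall_lt hT _)]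
    · rw [Finset.prod_range_succ', mul_comm,
        ← expSeq_removeMin_cylinder hq (hT 0) (fun j => T (j + 1)) (fun j => hT _)
          (le_max_right N₀ q)]
      congr 1
      ext u
      simp only [Set.mem_preimage, Set.mem_ofPred_eq]
      constructor
      · intro h
        refine ⟨by simpa [insertAt] using h 0 (by omega), fun j hj => ?_⟩
        simpa [insertAt] using h (j + 1) (by omega)
      · rintro ⟨h1, h2⟩ i hi
        rcases i with _ | i
        · simpa [insertAt] using h1
        · simpa [insertAt] using h2 i (by omega)
  calc expSeq.map (fun u => ((q : ℝ) * u (firstArgmin q u), removeMin q u))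
      = (expSeq.map (fun u => insertAt 0 ((q : ℝ) * u (firstArgmin q u)) (removeMin q u))).map
          (fun v => (v 0, fun j => v (j + 1))) := by
        rw [Measure.map_map hun hm2]
        congr 1
    _ = ((stdExp.prod expSeq).map (fun p => insertAt 0 p.1 p.2)).map
          (fun v => (v 0, fun j => v (j + 1))) := by rw [hcons, map_insertAt]
    _ = stdExp.prod expSeq := by
        rw [Measure.map_map hun (measurable_insertAt 0)]
        have : (fun v : ℕ → ℝ => (v 0, fun j => v (j + 1))) ∘
            (fun p : ℝ × (ℕ → ℝ) => insertAt 0 p.1 p.2) = id := by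
          funext p; exact hid p
        rw [this, Measure.map_id]

end Sequences

/-! ### Joint law of the innovations. -/

section Innovations

variable (r : ℕ → ℕ)

@[fun_prop]
lemma measurable_state (m : ℕ) : Measurable fun u => state r u m := by
  induction m with
  | zero => exact measurable_id
  | succ m ih =>
    simp only [state]
    split_ifs
    · exact (measurable_removeMin _).comp ih
    · exact ih

@[fun_prop]
lemma measurable_innov (m : ℕ) : Measurable fun u => innov r u m := by
  simp only [innov]
  split_ifs
  · exact ((measurable_eval (measurable_firstArgmin (r m))).comp (measurable_state r m)).const_mul _
  · exact measurable_const

/-- The law of the `m`-th innovation. -/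
def innovLaw (m : ℕ) : Measure ℝ := if r (m + 1) = r m then stdExp else Measure.dirac 0

instance (m : ℕ) : IsProbabilityMeasure (innovLaw r m) := by
  unfold innovLaw; split_ifs <;> infer_instance

variable {r}

/-- The current state keeps the law `expSeq` and is independent of all innovations so far. With `C`
arbitrary, a condition on the next innovation and the next state becomes one on the current state,
to which `map_min_removeMin` applies. -/
lemma expSeq_innov_state (hr : IsRankFunction r) (m : ℕ) {B : ℕ → Set ℝ}
    (hB : ∀ k, MeasurableSet (B k)) {C : Set (ℕ → ℝ)} (hC : MeasurableSet C) :
    expSeq {u | (∀ k < m, innov r u k ∈ B k) ∧ state r u m ∈ C} =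
      (∏ k ∈ Finset.range m, innovLaw r k (B k)) * expSeq C := by
  induction m generalizing C with
  | zero => simp [state]
  | succ m ih =>
    rw [Finset.prod_range_succ]
    by_cases hδ : r (m + 1) = r m
    · have hm : Measurable fun u : ℕ → ℝ => ((r m : ℝ) * u (firstArgmin (r m) u),
          removeMin (r m) u) :=
        ((measurable_eval (measurable_firstArgmin (r m))).const_mul _).prodMk
          (measurable_removeMin (r m))
      have h1 := ih (hm ((hB m).prod hC))
      rw [← Measure.map_apply hm ((hB m).prod hC), map_min_removeMin (hr.pos m),
        Measure.prod_prod, ← mul_assoc] at h1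
      rw [innovLaw, if_pos hδ, ← h1]
      congr 1
      ext u
      simp only [Set.mem_ofPred_eq, Set.mem_preimage, Set.mem_prod, state, if_pos hδ]
      have h2 : innov r u m = r m * state r u m (firstArgmin (r m) (state r u m)) := by
        rw [innov, if_pos hδ]
      rw [← h2]
      constructor
      · rintro ⟨h3, h4⟩
        exact ⟨fun k hk => h3 k (by omega), h3 m (by omega), h4⟩
      · rintro ⟨h3, h4, h5⟩
        refine ⟨fun k hk => ?_, h5⟩
        rcases Nat.lt_succ_iff_lt_or_eq.1 hk with hk | rfl
        exacts [h3 k hk, h4]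
    · rw [innovLaw, if_neg hδ, Measure.dirac_apply' _ (hB m)]
      have h2 : ∀ u, innov r u m = 0 := fun u => by rw [innov, if_neg hδ]
      by_cases h0 : (0 : ℝ) ∈ B m
      · rw [Set.indicator_of_mem h0, Pi.one_apply, mul_one, ← ih hC]
        congr 1
        ext u
        simp only [Set.mem_ofPred_eq, state, if_neg hδ]
        refine and_congr_left fun _ => ⟨fun h k hk => h k (by omega), fun h k hk => ?_⟩
        rcases Nat.lt_succ_iff_lt_or_eq.1 hk with hk | rfl
        · exact h k hk
        · rwa [h2]
      · rw [Set.indicator_of_notMem h0, mul_zero, zero_mul]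
        convert measure_empty (μ := expSeq)
        ext u
        simp only [Set.mem_ofPred_eq, Set.mem_empty_iff_false, iff_false, not_and]
        intro h
        exact absurd (h2 u ▸ h m (by omega)) h0

lemma expSeq_innov (hr : IsRankFunction r) (m : ℕ) {B : ℕ → Set ℝ}
    (hB : ∀ k, MeasurableSet (B k)) :
    expSeq {u | ∀ k < m, innov r u k ∈ B k} = ∏ k ∈ Finset.range m, innovLaw r k (B k) := by
  simpa using expSeq_innov_state hr m hB MeasurableSet.univ

lemma map_innov (hr : IsRankFunction r) (m : ℕ) :
    expSeq.map (fun u => innov r u m) = innovLaw r m := by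
  ext B hB
  rw [Measure.map_apply (measurable_innov r m) hB]
  have h := expSeq_innov hr (m + 1) (B := fun k => if k = m then B else Set.univ)
    (fun k => by split_ifs; exacts [hB, MeasurableSet.univ])
  rw [Finset.prod_range_succ, Finset.prod_eq_one, one_mul, if_pos rfl] at h
  · rw [← h]
    congr 1
    ext u
    simp only [Set.mem_preimage, Set.mem_ofPred_eq]
    refine ⟨fun hu k hk => ?_, fun hu => by simpa using hu m (by omega)⟩
    split_ifs with hkm
    exacts [hkm ▸ hu, trivial]
  · intro k hk
    rw [if_neg (by have := Finset.mem_range.1 hk; omega), measure_univ]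

lemma iIndepFun_innov (hr : IsRankFunction r) :
    iIndepFun (fun m (u : ℕ → ℝ) => innov r u m) expSeq := by
  rw [iIndepFun_iff_measure_inter_preimage_eq_mul]
  intro S B hB
  have hsS : ∀ i ∈ S, i < S.sup id + 1 := fun i hi => by
    have : i ≤ S.sup id := Finset.le_sup (f := id) hi
    omega
  classical
  have h := expSeq_innov hr (S.sup id + 1) (B := fun k => if k ∈ S then B k else Set.univ)
    (fun k => by split_ifs with hk; exacts [hB k hk, MeasurableSet.univ])
  have h2 : {u | ∀ k < S.sup id + 1, innov r u k ∈ if k ∈ S then B k else Set.univ} =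
      ⋂ i ∈ S, (fun u : ℕ → ℝ => innov r u i) ⁻¹' B i := by
    ext u
    simp only [Set.mem_ofPred_eq, Set.mem_iInter, Set.mem_preimage]
    refine ⟨fun hu i hi => by simpa [hi] using hu i (hsS i hi), fun hu k _ => ?_⟩
    split_ifs with hk
    exacts [hu k hk, trivial]
  rw [← h2, h, ← Finset.prod_subset (s₁ := S)]
  · refine Finset.prod_congr rfl fun i hi => ?_
    rw [if_pos hi, ← map_innov hr, Measure.map_apply (measurable_innov r i) (hB i hi)]
  · exact fun i hi => Finset.mem_range.2 (hsS i hi)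
  · intro i _ hi
    rw [if_neg hi, measure_univ]

end Innovations

/-! ### The filtration of past values and integration over the next one. -/

section Past

/-- The sequence `x` with the entries from position `n` on replaced by `0`. -/
def trunc (n : ℕ) (x : ℕ → ℝ) (i : ℕ) : ℝ := if i < n then x i else 0

@[fun_prop]
lemma measurable_trunc (n : ℕ) : Measurable (trunc n) := by
  refine measurable_pi_lambda _ fun i => ?_
  unfold trunc
  split_ifs <;> fun_prop

lemma trunc_apply {n i : ℕ} (h : i < n) (x : ℕ → ℝ) : trunc n x i = x i := if_pos h

lemma trunc_trunc {m n : ℕ} (h : m ≤ n) (x : ℕ → ℝ) : trunc m (trunc n x) = trunc m x := by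
  funext i
  unfold trunc
  split_ifs <;> first | rfl | omega

variable {Ω : Type*} {mΩ : MeasurableSpace Ω} {P : Measure Ω} {X : ℕ → Ω → ℝ}

/-- The filtration of the first `n` variables of a sequence. -/
def past (X : ℕ → Ω → ℝ) (hX : ∀ i, Measurable (X i)) : Filtration ℕ mΩ where
  seq n := MeasurableSpace.comap (fun ω => trunc n fun i => X i ω) inferInstance
  mono' m n h := by
    have : (fun ω => trunc m fun i => X i ω) =
        trunc m ∘ (fun ω => trunc n fun i => X i ω) := by
      funext ω; exact (trunc_trunc h _).symm
    simp only [this]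
    rw [← MeasurableSpace.comap_comp]
    exact MeasurableSpace.comap_mono (measurable_trunc m).comap_le
  le' n := ((measurable_trunc n).comp (measurable_pi_lambda _ hX)).comap_le

lemma measurable_past_trunc (hX : ∀ i, Measurable (X i)) (n : ℕ) :
    Measurable[past X hX n] fun ω => trunc n fun i => X i ω :=
  comap_measurable _

lemma measurable_past_self (hX : ∀ i, Measurable (X i)) (n : ℕ) :
    Measurable[past X hX (n + 1)] (X n) := by
  have h := (measurable_pi_apply n).comp (measurable_past_trunc hX (n + 1))
  have h2 : (fun x : ℕ → ℝ => x n) ∘ (fun ω => trunc (n + 1) fun i => X i ω) = X n := by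
    funext ω; exact trunc_apply n.lt_succ_self fun i => X i ω
  rwa [h2] at h

lemma indepFun_trunc [IsProbabilityMeasure P] (hX : ∀ i, Measurable (X i)) (hind : iIndepFun X P)
    (n : ℕ) : IndepFun (fun ω => trunc n fun i => X i ω) (X n) P := by
  have h := hind.indepFun_finset (Finset.range n) {n} (by simp) hX
  have hg : Measurable fun (v : Finset.range n → ℝ) (i : ℕ) =>
      if h : i ∈ Finset.range n then v ⟨i, h⟩ else 0 := by
    refine measurable_pi_lambda _ fun i => ?_
    split_ifs <;> fun_prop
  have hk : Measurable fun v : ({n} : Finset ℕ) → ℝ => v ⟨n, by simp⟩ := by fun_prop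
  have h2 := h.comp hg hk
  have he : (fun ω => trunc n fun i => X i ω) = (fun (v : Finset.range n → ℝ) (i : ℕ) =>
      if h : i ∈ Finset.range n then v ⟨i, h⟩ else 0) ∘ fun a i => X i a := by
    funext ω i
    simp only [Function.comp, trunc, Finset.mem_range]
    split_ifs <;> rfl
  rw [he]
  exact h2

lemma indep_past [IsProbabilityMeasure P] (hX : ∀ i, Measurable (X i)) (hind : iIndepFun X P)
    (n : ℕ) : Indep (MeasurableSpace.comap (X n) inferInstance) (past X hX n) P :=
  (indepFun_trunc hX hind n).symm

/-- Integrating out the next variable. -/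
lemma integral_past [IsProbabilityMeasure P] (hX : ∀ i, Measurable (X i)) (hind : iIndepFun X P)
    {n : ℕ} {ν : Measure ℝ} (hlaw : HasLaw (X n) ν P) {φ : (ℕ → ℝ) → ℝ → ℝ}
    (hφ : Measurable (Function.uncurry φ)) {C : ℝ} (hC : ∀ x s, |φ x s| ≤ C) :
    ∫ ω, φ (trunc n fun i => X i ω) (X n ω) ∂P =
      ∫ ω, ∫ s, φ (trunc n fun i => X i ω) s ∂ν ∂P := by
  have hU : Measurable fun ω => trunc n fun i => X i ω :=
    (measurable_trunc n).comp (measurable_pi_lambda _ hX)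
  have hν : IsProbabilityMeasure ν := by
    rw [← hlaw.map_eq]; exact Measure.isProbabilityMeasure_map hlaw.aemeasurable
  have hPU : IsProbabilityMeasure (P.map fun ω => trunc n fun i => X i ω) :=
    Measure.isProbabilityMeasure_map hU.aemeasurable
  have hprod := (indepFun_trunc hX hind n).map_prod_eq_prod_map_map hU.aemeasurable
    (hX n).aemeasurable
  rw [hlaw.map_eq] at hprod
  have h1 : ∫ ω, φ (trunc n fun i => X i ω) (X n ω) ∂P =
      ∫ p, Function.uncurry φ p ∂((P.map fun ω => trunc n fun i => X i ω).prod ν) := by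
    rw [← hprod, integral_map (hU.prodMk (hX n)).aemeasurable hφ.aestronglyMeasurable]
    rfl
  rw [h1, integral_prod]
  · rw [integral_map hU.aemeasurable]
    · rfl
    · exact (hφ.stronglyMeasurable.integral_prod_right (ν := ν)).aestronglyMeasurable
  · exact Integrable.of_bound hφ.aestronglyMeasurable C (ae_of_all _ fun p => hC p.1 p.2)

end Past

/-! ### Measurability and predictability of the process. -/

section Measurability

variable (r : ℕ → ℕ)

lemma measurable_threshold (s : Finset ℕ) : Measurable fun x => threshold r x s := by
  -- `kthLargest` uses its rank only through `k - 1`, so the rank may be written in a visibly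
  -- positive form.
  have h0 : (fun x : ℕ → ℝ => threshold r x s) =
      fun x => kthLargest (s.val.map x) (r s.card - 1 + 1) := rfl
  rw [h0]
  by_cases hk : r s.card - 1 + 1 ≤ s.card
  · refine measurable_of_Ioi fun t => ?_
    have h1 : (fun x : ℕ → ℝ => kthLargest (s.val.map x) (r s.card - 1 + 1)) ⁻¹' Set.Ioi t =
        {x | r s.card - 1 + 1 ≤ ∑ i ∈ s, if t < x i then 1 else 0} := by
      ext x
      rw [Set.mem_preimage, Set.mem_Ioi, lt_kthLargest_iff (by omega) (by simpa using hk),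
        Multiset.countP_map, Set.mem_ofPred_eq, ← Finset.card_filter]
      rfl
    rw [h1]
    refine measurableSet_le measurable_const (Finset.measurable_sum _ fun i _ => ?_)
    exact Measurable.ite (measurableSet_lt measurable_const (measurable_pi_apply i))
      measurable_const measurable_const
  · have : ∀ x : ℕ → ℝ, kthLargest (s.val.map x) (r s.card - 1 + 1) = 0 := fun x =>
      kthLargest_of_card_lt (by simpa using hk)
    simp only [this]
    exact measurable_const

/-- There are only countably many finite sets of candidates; on each the threshold is a fixed order
statistic. -/
lemma measurable_thr_of_hired {n : ℕ}
    (h : ∀ S : Set (Finset ℕ), MeasurableSet {x | hired r x n ∈ S}) :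
    Measurable fun x => thr r x n := by
  intro B hB
  have h1 : (fun x => thr r x n) ⁻¹' B =
      ⋃ s : Finset ℕ, {x | hired r x n ∈ ({s} : Set (Finset ℕ))} ∩
        (fun x => threshold r x s) ⁻¹' B := by
    ext x
    simp [thr]
  rw [h1]
  exact MeasurableSet.iUnion fun s => (h {s}).inter (measurable_threshold r s hB)

lemma measurableSet_hired (n : ℕ) (S : Set (Finset ℕ)) : MeasurableSet {x | hired r x n ∈ S} := by
  induction n generalizing S with
  | zero => exact MeasurableSet.const ((∅ : Finset ℕ) ∈ S)
  | succ n ih =>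
    have hlt : MeasurableSet {x : ℕ → ℝ | thr r x n < x n} :=
      measurableSet_lt (measurable_thr_of_hired r ih) (measurable_pi_apply n)
    have h1 : {x | hired r x (n + 1) ∈ S} =
        ({x | thr r x n < x n} ∩ {x | hired r x n ∈ {s | insert n s ∈ S}}) ∪
          ({x | thr r x n < x n}ᶜ ∩ {x | hired r x n ∈ S}) := by
      ext x
      by_cases h : thr r x n < x n <;> simp [hired_succ, h]
    rw [h1]
    exact (hlt.inter (ih _)).union (hlt.compl.inter (ih _))

@[fun_prop]
lemma measurable_thr (n : ℕ) : Measurable fun x => thr r x n :=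
  measurable_thr_of_hired r (measurableSet_hired r n)

@[fun_prop]
lemma measurable_numHired (n : ℕ) : Measurable fun x => numHired r x n := fun B _ =>
  measurableSet_hired r n {s | s.card ∈ B}

@[fun_prop]
lemma measurable_gapUpTo (n m : ℕ) : Measurable fun x => gapUpTo r x n m := by
  refine Finset.measurable_sum _ fun i _ => Measurable.ite ?_ (by fun_prop) measurable_const
  exact (measurable_numHired r i (measurableSet_singleton m)).inter
    (measurableSet_lt (measurable_thr r i) (measurable_pi_apply i))

variable {r}

lemma thr_trunc (n : ℕ) (x : ℕ → ℝ) : thr r (trunc n x) n = thr r x n :=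
  (hired_congr fun _ hi => trunc_apply hi x).2

lemma numHired_trunc (n : ℕ) (x : ℕ → ℝ) : numHired r (trunc n x) n = numHired r x n :=
  numHired_congr fun _ hi => trunc_apply hi x

lemma gapUpTo_trunc (n m : ℕ) (x : ℕ → ℝ) : gapUpTo r (trunc n x) n m = gapUpTo r x n m := by
  refine Finset.sum_congr rfl fun i hi => ?_
  have hi := Finset.mem_range.1 hi
  have h : ∀ j < i, trunc n x j = x j := fun j hj => trunc_apply (hj.trans hi) x
  rw [numHired_congr h, (hired_congr h).2, trunc_apply hi]

end Measurability

/-! ### The gaps are i.i.d. exponential. -/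

section GapLaw

variable {Ω : Type*} {mΩ : MeasurableSpace Ω} {P : Measure Ω} [IsProbabilityMeasure P]
  {r : ℕ → ℕ} {X : ℕ → Ω → ℝ}

/-- By the second Borel–Cantelli lemma every level is exceeded infinitely often. If acceptances
stopped, the threshold would freeze and a later value above it would still be accepted. -/
lemma ae_tendsto_numHired (hX : ∀ i, Measurable (X i)) (hind : iIndepFun X P)
    (hlaw : ∀ i, HasLaw (X i) stdExp P) :
    ∀ᵐ ω ∂P, Tendsto (numHired r fun i => X i ω) atTop atTop := by
  have h1 : ∀ c : ℕ, ∀ᵐ ω ∂P, ∃ᶠ n in atTop, (c : ℝ) < X n ω := by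
    intro c
    have hms : ∀ n, MeasurableSet {ω | (c : ℝ) < X n ω} := fun n =>
      measurableSet_lt measurable_const (hX n)
    have hindep : iIndepSet (fun n => {ω | (c : ℝ) < X n ω}) P := by
      rw [iIndepSet_iff_meas_biInter hms]
      exact fun S => hind.measure_inter_preimage_eq_mul S (sets := fun _ => Set.Ioi (c : ℝ))
        fun _ _ => measurableSet_Ioi
    have hval : ∀ n, P {ω | (c : ℝ) < X n ω} = ENNReal.ofReal (Real.exp (-c)) := fun n => by
      rw [← stdExp_Ioi c.cast_nonneg, ← (hlaw n).map_eq,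
        Measure.map_apply (hX n) measurableSet_Ioi]
      rfl
    have h := measure_limsup_eq_one hms hindep (by
      simp only [hval]
      refine ENNReal.tsum_const_eq_top_of_ne_zero ?_
      simp [Real.exp_pos])
    have hae : ∀ᵐ ω ∂P, ω ∈ limsup (fun n => {ω | (c : ℝ) < X n ω}) atTop := by
      rw [← prob_compl_eq_zero_iff₀ (MeasurableSet.measurableSet_limsup hms).nullMeasurableSet] at h
      exact h
    filter_upwards [hae] with ω hω
    exact mem_limsup_iff_frequently_mem.1 hω
  filter_upwards [ae_all_iff.2 h1] with ω hω
  by_contra hM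
  rw [tendsto_atTop_atTop_iff_of_monotone (numHired_mono _ _)] at hM
  push Not at hM
  obtain ⟨b, hb⟩ := hM
  obtain ⟨n₀, hn₀⟩ : ∃ n₀, ∀ n, numHired r (fun i => X i ω) n ≤ numHired r (fun i => X i ω) n₀ := by
    have hfin : (Set.range (numHired r fun i => X i ω)).Finite :=
      (Set.finite_Iio b).subset (by rintro _ ⟨n, rfl⟩; exact hb n)
    obtain ⟨_, ⟨n₀, rfl⟩, h⟩ := hfin.exists_maximalFor id _ (Set.range_nonempty _)
    refine ⟨n₀, fun n => ?_⟩
    rcases le_total (numHired r (fun i => X i ω) n) (numHired r (fun i => X i ω) n₀) with h' | h'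
    · exact h'
    · exact h ⟨n, rfl⟩ h'
  obtain ⟨c, hc⟩ := exists_nat_ge (thr r (fun i => X i ω) n₀)
  obtain ⟨n, hn, hcn⟩ := (hω c).forall_exists_of_atTop n₀
  have heq : numHired r (fun i => X i ω) n = numHired r (fun i => X i ω) n₀ :=
    le_antisymm (hn₀ n) (numHired_mono _ _ hn)
  have hthr : thr r (fun i => X i ω) n = thr r (fun i => X i ω) n₀ := by
    unfold thr; rw [hired_eq_of_numHired_eq _ _ heq]
  have h2 := hn₀ (n + 1)
  rw [numHired_succ, if_pos (by rw [hthr]; exact hc.trans_lt hcn)] at h2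
  omega

/-- The indicator of `gap j ∈ B j` if the `(j + 1)`-th acceptance is among the first `n`
candidates, and its expectation otherwise. -/
def gapWeight (r : ℕ → ℕ) (B : ℕ → Set ℝ) (x : ℕ → ℝ) (n j : ℕ) : ℝ :=
  if j < numHired r x n then (B j).indicator 1 (gapUpTo r x n j) else stdExp.real (B j)

lemma gapWeight_nonneg (B : ℕ → Set ℝ) (x : ℕ → ℝ) (n j : ℕ) : 0 ≤ gapWeight r B x n j := by
  unfold gapWeight
  split_ifs
  · exact Set.indicator_nonneg (fun _ _ => zero_le_one) _
  · exact measureReal_nonneg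

lemma gapWeight_le_one (B : ℕ → Set ℝ) (x : ℕ → ℝ) (n j : ℕ) : gapWeight r B x n j ≤ 1 := by
  unfold gapWeight
  split_ifs
  · exact Set.indicator_le_self' (fun _ _ => zero_le_one) _
  · exact measureReal_le_one

lemma measurable_gapWeight {B : ℕ → Set ℝ} (hB : ∀ i, MeasurableSet (B i)) (n j : ℕ) :
    Measurable fun x => gapWeight r B x n j := by
  refine Measurable.ite (measurableSet_lt measurable_const (measurable_numHired r n)) ?_
    measurable_const
  exact (measurable_one.indicator (hB j)).comp (measurable_gapUpTo r n j)

/-- Conditionally on exceeding `t`, the excess has law `stdExp`. -/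
lemma integral_excess {t : ℝ} (ht : 0 ≤ t) {B : Set ℝ} (hB : MeasurableSet B) :
    ∫ s, (Set.Ioi t).indicator (fun s => B.indicator 1 (s - t) - stdExp.real B) s ∂stdExp = 0 := by
  have hm : MeasurableSet {s : ℝ | t < s ∧ s - t ∈ B} :=
    measurableSet_Ioi.inter ((measurable_id.sub_const t) hB)
  have h1 : ∀ s, (Set.Ioi t).indicator (fun s => B.indicator 1 (s - t) - stdExp.real B) s =
      {s : ℝ | t < s ∧ s - t ∈ B}.indicator 1 s -
        (Set.Ioi t).indicator (fun _ => stdExp.real B) s := by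
    intro s
    by_cases h : t < s <;> by_cases h' : s - t ∈ B <;> simp [Set.indicator, h, h']
  simp_rw [h1]
  rw [integral_sub, integral_indicator_one hm, integral_indicator_const _ measurableSet_Ioi,
    measureReal_def, measureReal_def, measureReal_def, stdExp_memoryless ht hB, stdExp_Ioi ht,
    ENNReal.toReal_mul, smul_eq_mul, sub_self]
  · exact (integrable_const (1 : ℝ)).indicator hm
  · exact (integrable_const _).indicator measurableSet_Ioi

/-- The product is a martingale in `n`: a rejection changes nothing, an acceptance replaces one
factor by an indicator with that conditional mean. At `n = 0` it is the right-hand side. -/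
lemma integral_prod_gapWeight (hX : ∀ i, Measurable (X i)) (hind : iIndepFun X P)
    (hlaw : ∀ i, HasLaw (X i) stdExp P) {B : ℕ → Set ℝ} (hB : ∀ i, MeasurableSet (B i))
    (K n : ℕ) : ∫ ω, ∏ j ∈ Finset.range K, gapWeight r B (fun i => X i ω) n j ∂P =
      ∏ j ∈ Finset.range K, stdExp.real (B j) := by
  have hpath : Measurable fun ω i => X i ω := measurable_pi_lambda _ hX
  have hint : ∀ n, Integrable
      (fun ω => ∏ j ∈ Finset.range K, gapWeight r B (fun i => X i ω) n j) P := by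
    intro n
    refine Integrable.of_bound (C := 1) ?_ (ae_of_all _ fun ω => ?_)
    · exact (Finset.measurable_prod _ fun j _ =>
        (measurable_gapWeight hB n j).comp hpath).aestronglyMeasurable
    · rw [Real.norm_of_nonneg (Finset.prod_nonneg fun j _ => gapWeight_nonneg _ _ _ _)]
      exact Finset.prod_le_one (fun j _ => gapWeight_nonneg _ _ _ _)
        fun j _ => gapWeight_le_one _ _ _ _
  induction n with
  | zero => simp [gapWeight, numHired_zero]
  | succ n ih =>
    rw [← ih, ← sub_eq_zero, ← integral_sub (hint _) (hint _)]
    -- Candidate `n` can only change the factor of index `M_n`. `R` is the product without it, `ψ`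
    -- is its change, and `φ` is the resulting increment, which vanishes if that index is not below
    -- `K`.
    let R : (ℕ → ℝ) → ℝ := fun x =>
      ∏ j ∈ Finset.range K, if j = numHired r x n then 1 else gapWeight r B x n j
    let ψ : ℕ → ℝ → ℝ → ℝ := fun m t s =>
      (Set.Ioi t).indicator (fun s => (B m).indicator 1 (s - t) - stdExp.real (B m)) s
    let φ : (ℕ → ℝ) → ℝ → ℝ := fun x s =>
      (if numHired r x n < K then R x else 0) * ψ (numHired r x n) (thr r x n) s
    have hRm : Measurable R := Finset.measurable_prod _ fun j _ =>
      Measurable.ite (measurableSet_eq_fun measurable_const (measurable_numHired r n))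
        measurable_const (measurable_gapWeight hB n j)
    have hψm : ∀ m, Measurable fun p : ℝ × ℝ => ψ m p.1 p.2 := fun m => by
      have : (fun p : ℝ × ℝ => ψ m p.1 p.2) = {p : ℝ × ℝ | p.1 < p.2}.indicator
          (fun p => (B m).indicator 1 (p.2 - p.1) - stdExp.real (B m)) := by
        funext p
        simp [ψ, Set.indicator]
      rw [this]
      refine Measurable.indicator (Measurable.sub_const ?_ _)
        (measurableSet_lt measurable_fst measurable_snd)
      exact (measurable_one.indicator (hB m)).comp (measurable_snd.sub measurable_fst)
    have hφm : Measurable (Function.uncurry φ) := by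
      refine Measurable.mul ?_ ?_
      · refine Measurable.ite ?_ (hRm.comp measurable_fst) measurable_const
        exact measurableSet_lt ((measurable_numHired r n).comp measurable_fst) measurable_const
      · exact (measurable_from_prod_countable_right
          (f := fun p : ℕ × (ℝ × ℝ) => ψ p.1 p.2.1 p.2.2) hψm).comp
          (((measurable_numHired r n).comp measurable_fst).prodMk
            (((measurable_thr r n).comp measurable_fst).prodMk measurable_snd))
    have hR0 : ∀ x, 0 ≤ R x ∧ R x ≤ 1 := fun x => by
      have h1 : ∀ j, 0 ≤ (if j = numHired r x n then 1 else gapWeight r B x n j) ∧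
          (if j = numHired r x n then 1 else gapWeight r B x n j) ≤ 1 := fun j => by
        split_ifs
        · simp
        · exact ⟨gapWeight_nonneg _ _ _ _, gapWeight_le_one _ _ _ _⟩
      exact ⟨Finset.prod_nonneg fun j _ => (h1 j).1,
        Finset.prod_le_one (fun j _ => (h1 j).1) fun j _ => (h1 j).2⟩
    have hφb : ∀ x s, |φ x s| ≤ 1 := fun x s => by
      have h1 : |if numHired r x n < K then R x else 0| ≤ 1 := by
        split_ifs
        · rw [abs_of_nonneg (hR0 x).1]; exact (hR0 x).2
        · simp
      have h2 : |ψ (numHired r x n) (thr r x n) s| ≤ 1 := by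
        have h3 : 0 ≤ stdExp.real (B (numHired r x n)) := measureReal_nonneg
        have h4 : stdExp.real (B (numHired r x n)) ≤ 1 := measureReal_le_one
        simp only [ψ, Set.indicator]
        split_ifs <;> simp only [Pi.one_apply, abs_le] <;> constructor <;> linarith
      calc |φ x s| = |if numHired r x n < K then R x else 0| *
            |ψ (numHired r x n) (thr r x n) s| := abs_mul _ _
        _ ≤ 1 * 1 := mul_le_mul h1 h2 (abs_nonneg _) zero_le_one
        _ = 1 := one_mul 1
    have hstep : ∀ x : ℕ → ℝ, ∏ j ∈ Finset.range K, gapWeight r B x (n + 1) j -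
        ∏ j ∈ Finset.range K, gapWeight r B x n j = φ x (x n) := by
      intro x
      by_cases hlt : thr r x n < x n
      · have hother : ∀ j, j ≠ numHired r x n →
            gapWeight r B x (n + 1) j = gapWeight r B x n j := by
          intro j hj
          unfold gapWeight
          rw [numHired_succ, if_pos hlt]
          by_cases h : j < numHired r x n
          · rw [if_pos (by omega), if_pos h, gapUpTo_succ_of_lt h]
          · rw [if_neg (by omega), if_neg h]
        have hself : gapWeight r B x (n + 1) (numHired r x n) =
            (B (numHired r x n)).indicator 1 (x n - thr r x n) := by
          unfold gapWeight
          rw [numHired_succ, if_pos hlt, if_pos (by omega), gapUpTo_succ_self hlt]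
        have hself' : gapWeight r B x n (numHired r x n) = stdExp.real (B (numHired r x n)) := by
          unfold gapWeight
          rw [if_neg (by omega)]
        have hψ : ψ (numHired r x n) (thr r x n) (x n) =
            gapWeight r B x (n + 1) (numHired r x n) - gapWeight r B x n (numHired r x n) := by
          rw [hself, hself']
          exact Set.indicator_of_mem (s := Set.Ioi (thr r x n)) hlt _
        simp only [φ]
        rw [hψ]
        by_cases hK : numHired r x n < K
        · have hfac : ∀ n', (∀ j, j ≠ numHired r x n →
              gapWeight r B x n' j = gapWeight r B x n j) →
              ∏ j ∈ Finset.range K, gapWeight r B x n' j =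
                R x * gapWeight r B x n' (numHired r x n) := by
            intro n' hn'
            have hmem : numHired r x n ∈ Finset.range K := Finset.mem_range.2 hK
            simp only [R]
            rw [← Finset.mul_prod_erase _ _ hmem, ← Finset.mul_prod_erase _ _ hmem, if_pos rfl,
              one_mul, mul_comm]
            congr 1
            refine Finset.prod_congr rfl fun j hj => ?_
            rw [if_neg (Finset.ne_of_mem_erase hj), hn' j (Finset.ne_of_mem_erase hj)]
          rw [if_pos hK, hfac (n + 1) hother, hfac n fun _ _ => rfl]
          ring
        · rw [if_neg hK, zero_mul, sub_eq_zero]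
          refine Finset.prod_congr rfl fun j hj => hother j ?_
          have := Finset.mem_range.1 hj
          omega
      · have hsame : ∀ j, gapWeight r B x (n + 1) j = gapWeight r B x n j := by
          intro j
          unfold gapWeight
          rw [numHired_succ, if_neg hlt, add_zero]
          split_ifs with h
          · rw [gapUpTo_succ_of_lt h]
          · rfl
        have hψ : ψ (numHired r x n) (thr r x n) (x n) = 0 :=
          Set.indicator_of_notMem (s := Set.Ioi (thr r x n)) hlt _
        simp only [φ, hψ, hsame, sub_self, mul_zero]
    have hφt : ∀ x s, φ (trunc n x) s = φ x s := by
      intro x s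
      simp only [φ, R, gapWeight, numHired_trunc, thr_trunc, gapUpTo_trunc]
    calc ∫ ω, (∏ j ∈ Finset.range K, gapWeight r B (fun i => X i ω) (n + 1) j -
          ∏ j ∈ Finset.range K, gapWeight r B (fun i => X i ω) n j) ∂P
        = ∫ ω, φ (trunc n fun i => X i ω) (X n ω) ∂P := by
          refine integral_congr_ae (ae_of_all _ fun ω => ?_)
          simp only [hstep, hφt]
      _ = ∫ ω, ∫ s, φ (trunc n fun i => X i ω) s ∂stdExp ∂P :=
          integral_past hX hind (hlaw n) hφm hφb
      _ = ∫ ω, (0 : ℝ) ∂P := by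
          refine integral_congr_ae (ae_of_all _ fun ω => ?_)
          simp only [φ]
          rw [integral_const_mul, integral_excess (thr_nonneg _ _ _) (hB _), mul_zero]
      _ = 0 := by simp

lemma aemeasurable_gap (hX : ∀ i, Measurable (X i)) (hind : iIndepFun X P)
    (hlaw : ∀ i, HasLaw (X i) stdExp P) :
    AEMeasurable (fun ω => gap r fun i => X i ω) P := by
  refine aemeasurable_pi_lambda _ fun m => ?_
  refine aemeasurable_of_tendsto_metrizable_ae atTop
    (f := fun n ω => gapUpTo r (fun i => X i ω) n m)
    (fun n => ((measurable_gapUpTo r n m).comp (measurable_pi_lambda _ hX)).aemeasurable) ?_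
  filter_upwards [ae_tendsto_numHired (r := r) hX hind hlaw] with ω hM
  refine tendsto_const_nhds.congr' ?_
  filter_upwards [hM.eventually_gt_atTop m] with n hn
  exact (gapUpTo_eq_gap hM hn).symm

/-- The excesses of the accepted values over the thresholds are i.i.d. exponential. -/
lemma map_gap (hX : ∀ i, Measurable (X i)) (hind : iIndepFun X P)
    (hlaw : ∀ i, HasLaw (X i) stdExp P) :
    P.map (fun ω => gap r fun i => X i ω) = expSeq := by
  have hgm := aemeasurable_gap (r := r) hX hind hlaw
  have hpath : Measurable fun ω i => X i ω := measurable_pi_lambda _ hX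
  refine eq_infinitePi_of_range fun B hB K => ⟨K, le_rfl, ?_⟩
  have hSm := measurableSet_forall_lt hB K
  -- The expectations do not depend on `n`; once more than `K` acceptances have occurred, every
  -- factor is the indicator for the true gap.
  have hlim : Tendsto (fun n => ∫ ω, ∏ j ∈ Finset.range K,
      gapWeight r B (fun i => X i ω) n j ∂P) atTop
      (𝓝 (∫ ω, {u : ℕ → ℝ | ∀ i < K, u i ∈ B i}.indicator 1 (gap r fun i => X i ω) ∂P)) := by
    refine tendsto_integral_of_dominated_convergence (fun _ => 1) (fun n => ?_)
      (integrable_const _) (fun n => ae_of_all _ fun ω => ?_) ?_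
    · exact (Finset.measurable_prod _ fun j _ =>
        (measurable_gapWeight hB n j).comp hpath).aestronglyMeasurable
    · rw [Real.norm_of_nonneg (Finset.prod_nonneg fun j _ => gapWeight_nonneg _ _ _ _)]
      exact Finset.prod_le_one (fun j _ => gapWeight_nonneg _ _ _ _)
        fun j _ => gapWeight_le_one _ _ _ _
    · filter_upwards [ae_tendsto_numHired (r := r) hX hind hlaw] with ω hM
      refine tendsto_const_nhds.congr' ?_
      filter_upwards [hM.eventually_gt_atTop K] with n hn
      have h1 : ∀ j ∈ Finset.range K, gapWeight r B (fun i => X i ω) n j =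
          (B j).indicator 1 (gap r (fun i => X i ω) j) := by
        intro j hj
        have hj : j < numHired r (fun i => X i ω) n := (Finset.mem_range.1 hj).trans hn
        rw [gapWeight, if_pos hj, gapUpTo_eq_gap hM hj]
      rw [Finset.prod_congr rfl h1]
      by_cases h : ∀ i < K, gap r (fun i => X i ω) i ∈ B i
      · rw [Set.indicator_of_mem (s := {u : ℕ → ℝ | ∀ i < K, u i ∈ B i}) h]
        symm
        refine Finset.prod_eq_one fun j hj => ?_
        rw [Set.indicator_of_mem (h j (Finset.mem_range.1 hj))]
        rfl
      · rw [Set.indicator_of_notMem (s := {u : ℕ → ℝ | ∀ i < K, u i ∈ B i}) h]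
        push Not at h
        obtain ⟨i, hi, hi'⟩ := h
        exact (Finset.prod_eq_zero (Finset.mem_range.2 hi) (Set.indicator_of_notMem hi' _)).symm
  simp only [integral_prod_gapWeight hX hind hlaw hB K] at hlim
  have h2 := tendsto_nhds_unique tendsto_const_nhds hlim
  rw [← integral_map (φ := fun ω => gap r fun i => X i ω) hgm
    (f := {u : ℕ → ℝ | ∀ i < K, u i ∈ B i}.indicator 1)
    (measurable_one.indicator hSm).aestronglyMeasurable, integral_indicator_one hSm] at h2
  have : IsProbabilityMeasure (P.map fun ω => gap r fun i => X i ω) :=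
    Measure.isProbabilityMeasure_map hgm
  rw [← ENNReal.toReal_eq_toReal_iff' (measure_ne_top _ _)
    (ENNReal.prod_ne_top fun i _ => measure_ne_top _ _), ENNReal.toReal_prod]
  exact h2.symm

end GapLaw

/-! ### Convergence of square-integrable martingales. -/

section MartingaleConvergence

variable {Ω : Type*} {mΩ : MeasurableSpace Ω} {P : Measure Ω} [IsProbabilityMeasure P]

/-- A series of square integrable martingale differences converges almost surely if the sum of
the second moments is bounded. -/
theorem ae_exists_tendsto_sum_of_martingale_diff (F : Filtration ℕ mΩ) {ξ : ℕ → Ω → ℝ}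
    (hmeas : ∀ n, Measurable[F (n + 1)] (ξ n)) (hL2 : ∀ n, MemLp (ξ n) 2 P)
    (h0 : ∀ n, P[ξ n | F n] =ᵐ[P] 0) {C : ℝ}
    (hC : ∀ n, ∑ i ∈ Finset.range n, ∫ ω, ξ i ω ^ 2 ∂P ≤ C) :
    ∀ᵐ ω ∂P, ∃ l, Tendsto (fun n => ∑ i ∈ Finset.range n, ξ i ω) atTop (𝓝 l) := by
  let W : ℕ → Ω → ℝ := fun n ω => ∑ i ∈ Finset.range n, ξ i ω
  have hWsucc : ∀ n, W (n + 1) = W n + ξ n := fun n => by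
    funext ω; exact Finset.sum_range_succ _ _
  have hWmeas : ∀ n, StronglyMeasurable[F n] (W n) := by
    intro n
    refine Measurable.stronglyMeasurable (Finset.measurable_sum _ fun i hi => ?_)
    exact (hmeas i).mono (F.mono (Finset.mem_range.1 hi)) le_rfl
  have hWL2 : ∀ n, MemLp (W n) 2 P := fun n => memLp_finsetSum _ fun i _ => hL2 i
  have hint : ∀ n, Integrable (W n) P := fun n => (hWL2 n).integrable one_le_two
  have hξint : ∀ n, Integrable (ξ n) P := fun n => (hL2 n).integrable one_le_two
  have hmart : Martingale W F P := by
    refine martingale_nat hWmeas hint fun n => ?_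
    rw [hWsucc]
    filter_upwards [condExp_add (hint n) (hξint n) (F n), h0 n] with ω h1 h2
    rw [h1, Pi.add_apply, h2, condExp_of_stronglyMeasurable (F.le n) (hWmeas n) (hint n)]
    simp
  have hprod : ∀ n, Integrable (W n * ξ n) P := fun n => (hWL2 n).integrable_mul (hL2 n)
  -- `W n` is known at time `n`, so it is orthogonal to the next difference; the second moments
  -- therefore add up.
  have horth : ∀ n, ∫ ω, W n ω * ξ n ω ∂P = 0 := by
    intro n
    have h1 := condExp_mul_of_stronglyMeasurable_left (hWmeas n) (hprod n) (hξint n)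
    rw [← integral_condExp (F.le n) (f := fun ω => W n ω * ξ n ω)]
    refine integral_eq_zero_of_ae ?_
    filter_upwards [h1, h0 n] with ω h2 h3
    refine h2.trans ?_
    rw [Pi.mul_apply, h3]
    simp
  have hsq : ∀ n, ∫ ω, W n ω ^ 2 ∂P = ∑ i ∈ Finset.range n, ∫ ω, ξ i ω ^ 2 ∂P := by
    intro n
    induction n with
    | zero => simp [W]
    | succ n ih =>
      rw [Finset.sum_range_succ, ← ih]
      have h1 : ∀ ω, W (n + 1) ω ^ 2 = (W n ω ^ 2 + 2 * (W n ω * ξ n ω)) + ξ n ω ^ 2 := fun ω => by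
        rw [hWsucc, Pi.add_apply]; ring
      have hp : Integrable (fun ω => 2 * (W n ω * ξ n ω)) P := (hprod n).const_mul 2
      simp_rw [h1]
      have hs : Integrable (fun ω => W n ω ^ 2 + 2 * (W n ω * ξ n ω)) P :=
        (hWL2 n).integrable_sq.add hp
      rw [integral_add hs (hL2 n).integrable_sq,
        integral_add (hWL2 n).integrable_sq hp, integral_const_mul, horth, mul_zero, add_zero]
  have hL1 : ∀ n, eLpNorm (W n) 1 P ≤ (1 + C).toNNReal := by
    intro n
    rw [eLpNorm_one_eq_lintegral_enorm, ← ofReal_integral_norm_eq_lintegral_enorm (hint n)]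
    refine ENNReal.ofReal_le_ofReal ?_
    calc ∫ ω, ‖W n ω‖ ∂P ≤ ∫ ω, (1 + W n ω ^ 2) ∂P := by
          refine integral_mono (hint n).norm ((integrable_const 1).add (hWL2 n).integrable_sq)
            fun ω => ?_
          have := sq_nonneg (|W n ω| - 1)
          simp only [Real.norm_eq_abs]
          nlinarith [sq_abs (W n ω), abs_nonneg (W n ω)]
      _ = 1 + ∫ ω, W n ω ^ 2 ∂P := by
          rw [integral_add (integrable_const 1) (hWL2 n).integrable_sq]; simp
      _ ≤ 1 + C := by rw [hsq]; linarith [hC n]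
  filter_upwards [hmart.submartingale.ae_tendsto_limitProcess hL1] with ω hω
  exact ⟨_, hω⟩

end MartingaleConvergence

/-! ### Almost sure convergence of the series `Z`. -/

section InnovationSeries

variable {r : ℕ → ℕ}

lemma stdExp_eq_withDensity_restrict :
    stdExp = (volume.restrict (Set.Ioi 0)).withDensity fun s => ENNReal.ofReal (Real.exp (-s)) := by
  rw [← withDensity_indicator measurableSet_Ioi, stdExp_eq]
  refine withDensity_congr_ae ?_
  have h0 : ∀ᵐ s : ℝ, s ≠ 0 := by rw [ae_iff]; simp
  filter_upwards [h0] with s hs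
  rcases lt_or_gt_of_ne hs with h | h
  · rw [exponentialPDF_of_neg h, Set.indicator_of_notMem (by simpa using h.le)]
  · rw [exponentialPDF_of_nonneg h.le, Set.indicator_of_mem (Set.mem_Ioi.2 h), one_mul, one_mul]

lemma stdExp_pow (k : ℕ) : Integrable (fun s : ℝ => s ^ k) stdExp ∧
    ∫ s, s ^ k ∂stdExp = Real.Gamma (k + 1) := by
  have hk : (0 : ℝ) < k + 1 := by positivity
  have hmeas : Measurable fun s : ℝ => ENNReal.ofReal (Real.exp (-s)) := by fun_prop
  have hfin : ∀ᵐ s ∂(volume.restrict (Set.Ioi (0 : ℝ))), ENNReal.ofReal (Real.exp (-s)) < ⊤ :=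
    ae_of_all _ fun s => ENNReal.ofReal_lt_top
  have heq : (fun s : ℝ => (ENNReal.ofReal (Real.exp (-s))).toReal • s ^ k) =
      fun s => Real.exp (-s) * s ^ ((k + 1 : ℝ) - 1) := by
    funext s
    rw [ENNReal.toReal_ofReal (Real.exp_pos _).le, add_sub_cancel_right, Real.rpow_natCast,
      smul_eq_mul]
  rw [stdExp_eq_withDensity_restrict]
  constructor
  · rw [integrable_withDensity_iff_integrable_smul' hmeas hfin, heq]
    exact Real.GammaIntegral_convergent hk
  · rw [integral_withDensity_eq_integral_toReal_smul hmeas hfin, heq, Real.Gamma_eq_integral hk]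

lemma stdExp_sub_one : MemLp (fun s : ℝ => s - 1) 2 stdExp ∧ ∫ s, (s - 1) ∂stdExp = 0 := by
  have h1 : Integrable (fun s : ℝ => s) stdExp ∧ ∫ s, s ∂stdExp = 1 := by
    simpa [one_add_one_eq_two, Real.Gamma_two] using stdExp_pow 1
  constructor
  · have h2 : MemLp (fun s : ℝ => s) 2 stdExp :=
      (memLp_two_iff_integrable_sq measurable_id.aestronglyMeasurable).2 (stdExp_pow 2).1
    exact h2.sub (memLp_const 1)
  · rw [integral_sub h1.1 (integrable_const 1), h1.2]
    simp

/-- The centred and weighted innovations. -/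
def centred (r : ℕ → ℕ) (k : ℕ) (s : ℝ) : ℝ := delta r (k + 1) / (r (k + 1) : ℝ) * (s - 1)

lemma memLp_centred (k : ℕ) : MemLp (centred r k) 2 (innovLaw r k) ∧
    ∫ s, centred r k s ∂(innovLaw r k) = 0 := by
  unfold centred
  by_cases h : r (k + 1) = r k
  · rw [innovLaw, if_pos h]
    refine ⟨stdExp_sub_one.1.const_mul _, ?_⟩
    rw [integral_const_mul, stdExp_sub_one.2, mul_zero]
  · have : delta r (k + 1) = 0 := by simp [delta, h]
    simp [this]

/-- Independence makes the terms martingale differences for the filtration of the innovations, and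
their second moments are at most `V / r(k+1)^2`. -/
lemma ae_tendsto_centred (hr : IsRankFunction r)
    (hlarge : Summable (fun m : ℕ => 1 / (r m : ℝ) ^ 2)) :
    ∀ᵐ u ∂expSeq, ∃ l, Tendsto (fun n => ∑ k ∈ Finset.range n, centred r k (innov r u k))
      atTop (𝓝 l) := by
  have hm : ∀ k, Measurable fun u => innov r u k := measurable_innov r
  have hcm : ∀ k, Measurable (centred r k) := fun k => by unfold centred; fun_prop
  have hlaw : ∀ k, MeasurePreserving (fun u => innov r u k) expSeq (innovLaw r k) := fun k =>
    ⟨hm k, map_innov hr k⟩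
  have hL2 : ∀ k, MemLp (fun u => centred r k (innov r u k)) 2 expSeq := fun k =>
    (memLp_centred k).1.comp_measurePreserving (hlaw k)
  set V := ∫ s, (s - 1) ^ 2 ∂stdExp with hV
  have hV0 : 0 ≤ V := integral_nonneg fun s => sq_nonneg _
  refine ae_exists_tendsto_sum_of_martingale_diff (past (fun k u => innov r u k) hm)
    (C := (∑' m, 1 / (r (m + 1) : ℝ) ^ 2) * V) (fun k => ?_) hL2 (fun k => ?_) (fun n => ?_)
  · exact (hcm k).comp (measurable_past_self hm k)
  · have h1 := condExp_indep_eq (μ := expSeq) (hm k).comap_le ((past _ hm).le k)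
      (f := fun u => centred r k (innov r u k))
      ((hcm k).comp (comap_measurable fun u => innov r u k)).stronglyMeasurable
      (indep_past hm (iIndepFun_innov hr) k)
    refine h1.trans (ae_of_all _ fun u => ?_)
    rw [← integral_map (φ := fun u => innov r u k) (f := centred r k) (hm k).aemeasurable
      (hcm k).aestronglyMeasurable, map_innov hr, (memLp_centred k).2]
    rfl
  · have hsum : Summable fun m => 1 / (r (m + 1) : ℝ) ^ 2 :=
      (summable_nat_add_iff 1).2 hlarge
    calc ∑ k ∈ Finset.range n, ∫ u, centred r k (innov r u k) ^ 2 ∂expSeq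
        ≤ ∑ k ∈ Finset.range n, 1 / (r (k + 1) : ℝ) ^ 2 * V := by
          refine Finset.sum_le_sum fun k _ => ?_
          rw [← integral_map (φ := fun u => innov r u k) (f := fun s => centred r k s ^ 2)
            (hm k).aemeasurable ((hcm k).pow_const 2).aestronglyMeasurable, map_innov hr]
          unfold centred
          by_cases h : r (k + 1) = r k
          · rw [innovLaw, if_pos h]
            simp_rw [mul_pow]
            rw [integral_const_mul, ← hV, delta, Nat.add_sub_cancel, if_pos h]
            rw [div_pow, one_pow]
          · have : delta r (k + 1) = 0 := by simp [delta, h]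
            simp only [this]
            simp
            positivity
      _ = (∑ k ∈ Finset.range n, 1 / (r (k + 1) : ℝ) ^ 2) * V := by rw [Finset.sum_mul]
      _ ≤ _ := mul_le_mul_of_nonneg_right
          (hsum.sum_le_tsum _ fun i _ => by positivity) hV0

end InnovationSeries

/-! ### Kronecker's lemma and weighted averages. -/

section Averages

/-- Kronecker's lemma. -/
lemma tendsto_sum_div_of_tendsto_sum {b ξ : ℕ → ℝ} (hb : Monotone b) (hbtop : Tendsto b atTop atTop)
    {l : ℝ} (h : Tendsto (fun n => ∑ i ∈ Finset.range n, ξ i) atTop (𝓝 l)) :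
    Tendsto (fun n => (∑ i ∈ Finset.range n, b i * ξ i) / b n) atTop (𝓝 0) := by
  set t : ℕ → ℝ := fun n => (∑ i ∈ Finset.range n, ξ i) - l with ht
  have ht0 : Tendsto t atTop (𝓝 0) := by simpa [ht] using h.sub_const l
  -- Summation by parts against the error `t`: after division by `b n`, the middle sum is a weighted
  -- average of a null sequence.
  have habel : ∀ n, ∑ i ∈ Finset.range n, b i * ξ i =
      b n * t n - ∑ i ∈ Finset.range n, t (i + 1) * (b (i + 1) - b i) + b 0 * l := by
    intro n
    induction n with
    | zero => simp [ht]
    | succ n ih =>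
      rw [Finset.sum_range_succ, ih, Finset.sum_range_succ (fun i => t (i + 1) * _)]
      have : t (n + 1) = t n + ξ n := by simp only [ht, Finset.sum_range_succ]; ring
      rw [this]
      ring
  have hsum : Tendsto (fun n => ∑ i ∈ Finset.range n, (b (i + 1) - b i)) atTop atTop := by
    simp_rw [Finset.sum_range_sub]
    exact tendsto_atTop_add_const_right _ _ hbtop
  have ho : (fun n => ∑ i ∈ Finset.range n, t (i + 1) * (b (i + 1) - b i)) =o[atTop]
      fun n => ∑ i ∈ Finset.range n, (b (i + 1) - b i) := by
    refine Asymptotics.IsLittleO.sum_range ?_ (fun i => sub_nonneg.2 (hb i.le_succ)) hsum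
    have h1 : (fun i => t (i + 1)) =o[atTop] fun _ => (1 : ℝ) :=
      (Asymptotics.isLittleO_one_iff ℝ).2 (ht0.comp (tendsto_add_atTop_nat 1))
    simpa using h1.mul_isBigO (Asymptotics.isBigO_refl (fun i => b (i + 1) - b i) atTop)
  have hO : (fun n => ∑ i ∈ Finset.range n, (b (i + 1) - b i)) =O[atTop] b := by
    simp_rw [Finset.sum_range_sub]
    refine (Asymptotics.isBigO_refl b atTop).sub ?_
    exact ((Asymptotics.isLittleO_const_left).2
      (Or.inr (tendsto_abs_atTop_atTop.comp hbtop))).isBigO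
  have h2 := (ho.trans_isBigO hO).tendsto_div_nhds_zero
  have h3 : Tendsto (fun n => b 0 * l / b n) atTop (𝓝 0) := hbtop.const_div_atTop _
  have h4 : Tendsto (fun n => t n - (∑ i ∈ Finset.range n, t (i + 1) * (b (i + 1) - b i)) / b n +
      b 0 * l / b n) atTop (𝓝 0) := by simpa using (ht0.sub h2).add h3
  refine h4.congr' ?_
  filter_upwards [hbtop.eventually_gt_atTop 0] with n hn
  rw [habel]
  field_simp

/-- Weighted Cesàro averages. -/
lemma tendsto_weighted_average {a g : ℕ → ℝ} (hg : ∀ i, 0 ≤ g i)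
    (hsum : Tendsto (fun n => ∑ i ∈ Finset.range n, g i) atTop atTop) {l : ℝ}
    (ha : Tendsto a atTop (𝓝 l)) :
    Tendsto (fun n => (∑ i ∈ Finset.range n, a i * g i) / ∑ i ∈ Finset.range n, g i)
      atTop (𝓝 l) := by
  have h1 : (fun i => (a i - l) * g i) =o[atTop] g := by
    have h0 : Tendsto (fun i => a i - l) atTop (𝓝 0) := by simpa using ha.sub_const l
    have h1 : (fun i => a i - l) =o[atTop] fun _ => (1 : ℝ) :=
      (Asymptotics.isLittleO_one_iff ℝ).2 h0
    simpa using h1.mul_isBigO (Asymptotics.isBigO_refl g atTop)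
  have h2 := (h1.sum_range (fun i => hg i) hsum).tendsto_div_nhds_zero
  have h3 : Tendsto (fun n => (∑ i ∈ Finset.range n, (a i - l) * g i) /
      (∑ i ∈ Finset.range n, g i) + l) atTop (𝓝 l) := by simpa using h2.add_const l
  refine h3.congr' ?_
  filter_upwards [hsum.eventually_gt_atTop 0] with n hn
  simp_rw [sub_mul]
  rw [Finset.sum_sub_distrib, ← Finset.mul_sum]
  field_simp
  ring

end Averages

/-! ### Growth of `lam`. -/

section Normalization

variable {r : ℕ → ℕ}

lemma y_succ (m : ℕ) : y r (m + 1) = y r m + delta r (m + 1) / (r (m + 1) : ℝ) :=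
  Finset.sum_Icc_succ_top (by omega) _

lemma delta_nonneg (k : ℕ) : 0 ≤ delta r k := by unfold delta; split_ifs <;> norm_num

lemma delta_le_one (k : ℕ) : delta r k ≤ 1 := by unfold delta; split_ifs <;> norm_num

lemma y_nonneg (m : ℕ) : 0 ≤ y r m :=
  Finset.sum_nonneg fun k _ => div_nonneg (delta_nonneg k) (Nat.cast_nonneg _)

lemma lam_succ (m : ℕ) : lam r (m + 1) = lam r m + Real.exp (y r m) := Finset.sum_range_succ _ _

lemma le_lam (m : ℕ) : (m : ℝ) ≤ lam r m := by
  induction m with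
  | zero => simp [lam]
  | succ m ih =>
    rw [lam_succ]
    push_cast
    linarith [Real.one_le_exp (y_nonneg (r := r) m)]

lemma one_le_lam_succ (m : ℕ) : 1 ≤ lam r (m + 1) := by
  refine le_trans ?_ (le_lam (m + 1))
  push_cast
  linarith [(Nat.cast_nonneg m : (0 : ℝ) ≤ m)]

lemma lam_mono : Monotone (lam r) :=
  monotone_nat_of_le_succ fun m => by rw [lam_succ]; linarith [Real.exp_pos (y r m)]

lemma tendsto_lam : Tendsto (lam r) atTop atTop :=
  tendsto_atTop_mono le_lam tendsto_natCast_atTop_atTop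

/-- The rank grows by at most one per step, so over the last `r k / 2` indices it is at least `r k /
2`, and `y` varies there by at most `1`. Hence at least `r k / 2` terms of `lam r (k + 1)` are no
smaller than `exp (y r k - 1)`. -/
lemma exp_y_div_lam_le (hr : IsRankFunction r) (k : ℕ) :
    Real.exp (y r k) / lam r (k + 1) ≤ 2 * Real.exp 1 / r k := by
  have hk := hr.pos k
  have hk' := hr.le k
  -- This is at most `k`, because `r k ≤ k + 1`, and satisfies `2 * h ≤ r k ≤ 2 * (h + 1)`.
  set h := (r k - 1) / 2 with hh
  have hr0 : (0 : ℝ) < r k := by exact_mod_cast hk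
  have hy : ∀ i ≤ h, y r k ≤ y r (k - i) + i * (2 / r k) := by
    intro i
    induction i with
    | zero => simp
    | succ i ih =>
      intro hi
      have h1 := ih (by omega)
      have h2 : k - i = (k - (i + 1)) + 1 := by omega
      have h3 : r k ≤ r (k - i) + i := by
        have := hr.le_add (k - i) i
        rwa [Nat.sub_add_cancel (by omega)] at this
      have h4 : (r k : ℝ) ≤ 2 * r (k - i) := by
        have : r k ≤ 2 * r (k - i) := by omega
        exact_mod_cast this
      have h5 : (0 : ℝ) < r (k - i) := by linarith
      have h6 : delta r (k - i) / (r (k - i) : ℝ) ≤ 2 / r k := by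
        rw [div_le_div_iff₀ h5 hr0]
        nlinarith [delta_le_one (r := r) (k - i)]
      have h7 : y r (k - i) = y r (k - (i + 1)) + delta r (k - i) / (r (k - i) : ℝ) := by
        conv_lhs => rw [h2, y_succ, ← h2]
      push_cast
      linarith
  have hy' : ∀ j ∈ Finset.Ico (k - h) (k + 1), Real.exp (y r k - 1) ≤ Real.exp (y r j) := by
    intro j hj
    rw [Finset.mem_Ico] at hj
    refine Real.exp_le_exp.2 ?_
    have h1 := hy (k - j) (by omega)
    rw [show k - (k - j) = j by omega] at h1
    have h2 : ((k - j : ℕ) : ℝ) * (2 / r k) ≤ 1 := by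
      rw [← mul_div_assoc, div_le_one hr0]
      exact_mod_cast (by omega : (k - j) * 2 ≤ r k)
    linarith
  have hlow : (r k : ℝ) / 2 * Real.exp (y r k - 1) ≤ lam r (k + 1) := by
    calc (r k : ℝ) / 2 * Real.exp (y r k - 1)
        ≤ (h + 1 : ℕ) * Real.exp (y r k - 1) := by
          refine mul_le_mul_of_nonneg_right ?_ (Real.exp_pos _).le
          rw [div_le_iff₀ two_pos]
          exact_mod_cast (by omega : r k ≤ (h + 1) * 2)
      _ = ∑ _j ∈ Finset.Ico (k - h) (k + 1), Real.exp (y r k - 1) := by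
          rw [Finset.sum_const, Nat.card_Ico, nsmul_eq_mul]
          congr 2
          omega
      _ ≤ ∑ j ∈ Finset.Ico (k - h) (k + 1), Real.exp (y r j) := Finset.sum_le_sum hy'
      _ ≤ lam r (k + 1) := by
          refine Finset.sum_le_sum_of_subset_of_nonneg (fun j hj => ?_)
            fun _ _ _ => (Real.exp_pos _).le
          rw [Finset.mem_Ico] at hj
          exact Finset.mem_range.2 hj.2
  have hlam : 0 < lam r (k + 1) := zero_lt_one.trans_le (one_le_lam_succ k)
  rw [div_le_div_iff₀ hlam hr0]
  have hexp : Real.exp (y r k) = Real.exp 1 * Real.exp (y r k - 1) := by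
    rw [← Real.exp_add]; ring_nf
  rw [hexp]
  nlinarith [Real.exp_pos 1]

lemma summable_sq_ratio (hr : IsRankFunction r)
    (hlarge : Summable (fun m : ℕ => 1 / (r m : ℝ) ^ 2)) :
    Summable fun k => (Real.exp (y r k) / lam r (k + 1)) ^ 2 := by
  refine Summable.of_nonneg_of_le (fun k => sq_nonneg _) (fun k => ?_)
    (hlarge.mul_left ((2 * Real.exp 1) ^ 2))
  have hlam : 0 < lam r (k + 1) := zero_lt_one.trans_le (one_le_lam_succ k)
  calc (Real.exp (y r k) / lam r (k + 1)) ^ 2 ≤ (2 * Real.exp 1 / r k) ^ 2 :=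
        pow_le_pow_left₀ (by positivity) (exp_y_div_lam_le hr k) 2
    _ = _ := by rw [div_pow, mul_one_div]

/-- The complement to `1` is `exp (y r m) / lam r (m + 1)`, whose squares are summable. -/
lemma tendsto_lam_div_lam_succ (hr : IsRankFunction r)
    (hlarge : Summable (fun m : ℕ => 1 / (r m : ℝ) ^ 2)) :
    Tendsto (fun m => lam r m / lam r (m + 1)) atTop (𝓝 1) := by
  have h1 := (summable_sq_ratio hr hlarge).tendsto_atTop_zero.sqrt
  have hlam : ∀ k, 0 < lam r (k + 1) := fun k => zero_lt_one.trans_le (one_le_lam_succ k)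
  have h2 : Tendsto (fun m => 1 - Real.exp (y r m) / lam r (m + 1)) atTop (𝓝 1) := by
    rw [Real.sqrt_zero] at h1
    have h3 : ∀ m, √((Real.exp (y r m) / lam r (m + 1)) ^ 2) = Real.exp (y r m) / lam r (m + 1) :=
      fun m => Real.sqrt_sq (div_nonneg (Real.exp_pos _).le (hlam m).le)
    simp_rw [h3] at h1
    simpa using h1.const_sub 1
  refine h2.congr fun m => ?_
  have := (hlam m).ne'
  rw [lam_succ] at this ⊢
  field_simp
  ring

end Normalization

/-! ### The compensated count of acceptances, weighted and truncated. -/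

section Compensation

variable (r : ℕ → ℕ)

/-- The squared relative size of the expected waiting time at time `n`. -/
def cost (x : ℕ → ℝ) (n : ℕ) : ℝ := (Real.exp (thr r x n) / lam r (numHired r x n + 1)) ^ 2

/-- The sum of the costs at the acceptances before time `n`, and at time `n`. -/
def cumCost (x : ℕ → ℝ) (n : ℕ) : ℝ :=
  (∑ i ∈ Finset.range n, if thr r x i < x i then cost r x i else 0) + cost r x n

/-- The truncated weight `1 / λ_{M_n + 1}`. -/
def weight (C : ℝ) (x : ℕ → ℝ) (n : ℕ) : ℝ :=
  if cumCost r x n ≤ C then (lam r (numHired r x n + 1))⁻¹ else 0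

/-- The weighted compensated acceptance indicator at time `n`, as a function of the past and of
the value `s` of the current candidate. -/
def compensated (C : ℝ) (n : ℕ) (x : ℕ → ℝ) (s : ℝ) : ℝ :=
  weight r C x n * (1 - if thr r x n < s then Real.exp (thr r x n) else 0)

lemma cost_nonneg (x : ℕ → ℝ) (n : ℕ) : 0 ≤ cost r x n := sq_nonneg _

@[fun_prop]
lemma measurable_lam_numHired (n : ℕ) : Measurable fun x => lam r (numHired r x n + 1) :=
  (measurable_of_countable fun m => lam r (m + 1)).comp (measurable_numHired r n)

@[fun_prop]
lemma measurable_cost (n : ℕ) : Measurable fun x => cost r x n := by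
  unfold cost; fun_prop

@[fun_prop]
lemma measurable_cumCost (n : ℕ) : Measurable fun x => cumCost r x n := by
  refine Measurable.add (Finset.measurable_sum _ fun i _ => ?_) (measurable_cost r n)
  exact Measurable.ite (measurableSet_lt (measurable_thr r i) (measurable_pi_apply i))
    (measurable_cost r i) measurable_const

@[fun_prop]
lemma measurable_weight (C : ℝ) (n : ℕ) : Measurable fun x => weight r C x n :=
  Measurable.ite (measurableSet_le (measurable_cumCost r n) measurable_const)
    (measurable_lam_numHired r n).inv measurable_const

lemma measurable_thr_indicator (n : ℕ) : Measurable fun p : (ℕ → ℝ) × ℝ =>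
    if thr r p.1 n < p.2 then Real.exp (thr r p.1 n) else 0 := by
  have h : Measurable fun p : (ℕ → ℝ) × ℝ => thr r p.1 n := (measurable_thr r n).comp measurable_fst
  exact Measurable.ite (measurableSet_lt h measurable_snd) h.exp measurable_const

lemma measurable_compensated (C : ℝ) (n : ℕ) :
    Measurable (Function.uncurry (compensated r C n)) :=
  ((measurable_weight r C n).comp measurable_fst).mul
    ((measurable_thr_indicator r n).const_sub 1)

variable {r}

lemma cumCost_trunc (n : ℕ) (x : ℕ → ℝ) : cumCost r (trunc n x) n = cumCost r x n := by
  have h : ∀ i ≤ n, ∀ j < i, trunc n x j = x j := fun i hi j hj => trunc_apply (by omega) x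
  have hcost : ∀ i ≤ n, cost r (trunc n x) i = cost r x i := fun i hi => by
    unfold cost
    rw [numHired_congr (h i hi), (hired_congr (h i hi)).2]
  unfold cumCost
  rw [hcost n le_rfl]
  congr 1
  refine Finset.sum_congr rfl fun i hi => ?_
  have hi := Finset.mem_range.1 hi
  rw [hcost i hi.le, (hired_congr (h i hi.le)).2, trunc_apply hi]

lemma weight_trunc (C : ℝ) (n : ℕ) (x : ℕ → ℝ) : weight r C (trunc n x) n = weight r C x n := by
  unfold weight; rw [cumCost_trunc, numHired_trunc]

lemma compensated_trunc (C : ℝ) (n : ℕ) (x : ℕ → ℝ) (s : ℝ) :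
    compensated r C n (trunc n x) s = compensated r C n x s := by
  unfold compensated; rw [weight_trunc, thr_trunc]

lemma weight_nonneg (C : ℝ) (x : ℕ → ℝ) (n : ℕ) : 0 ≤ weight r C x n := by
  unfold weight
  split_ifs
  · exact inv_nonneg.2 (zero_le_one.trans (one_le_lam_succ _))
  · exact le_rfl

lemma weight_le_one (C : ℝ) (x : ℕ → ℝ) (n : ℕ) : weight r C x n ≤ 1 := by
  unfold weight
  split_ifs
  · exact inv_le_one_of_one_le₀ (one_le_lam_succ _)
  · exact zero_le_one

lemma sq_weight_mul_exp (C : ℝ) (x : ℕ → ℝ) (n : ℕ) :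
    (weight r C x n * Real.exp (thr r x n)) ^ 2 =
      if cumCost r x n ≤ C then cost r x n else 0 := by
  unfold weight cost
  split_ifs
  · congr 1; ring
  · simp

lemma cost_le_cumCost (x : ℕ → ℝ) (n : ℕ) : cost r x n ≤ cumCost r x n := by
  unfold cumCost
  have : 0 ≤ ∑ i ∈ Finset.range n, if thr r x i < x i then cost r x i else 0 :=
    Finset.sum_nonneg fun i _ => by split_ifs; exacts [cost_nonneg r x i, le_rfl]
  linarith

lemma weight_mul_exp_le {C : ℝ} (hC : 0 ≤ C) (x : ℕ → ℝ) (n : ℕ) :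
    weight r C x n * Real.exp (thr r x n) ≤ √C := by
  refine Real.le_sqrt_of_sq_le ?_
  rw [sq_weight_mul_exp]
  split_ifs with h
  · exact (cost_le_cumCost x n).trans h
  · exact hC

lemma abs_compensated_le {C : ℝ} (hC : 0 ≤ C) (n : ℕ) (x : ℕ → ℝ) (s : ℝ) :
    |compensated r C n x s| ≤ 1 + √C := by
  have h1 := weight_mul_exp_le (r := r) hC x n
  have h2 := weight_nonneg (r := r) C x n
  have h3 := weight_le_one (r := r) C x n
  have h4 := Real.sqrt_nonneg C
  have h5 := mul_nonneg h2 (Real.exp_pos (thr r x n)).le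
  unfold compensated
  split_ifs <;> rw [abs_le] <;> constructor <;> nlinarith

/-- A term is admitted only if the accepted costs so far together with its own stay below `C`, so
the truncation gives a pathwise bound. -/
lemma sum_accepted_cost_le {C : ℝ} (hC : 0 ≤ C) (x : ℕ → ℝ) (n : ℕ) :
    ∑ i ∈ Finset.range n, (if thr r x i < x i then
      (weight r C x i * Real.exp (thr r x i)) ^ 2 else 0) ≤ C := by
  -- The second bound, by the untruncated accepted costs, is what lets `cumCost ≤ C` control the sum
  -- after a new term.
  have key : ∑ i ∈ Finset.range n, (if thr r x i < x i then
      (weight r C x i * Real.exp (thr r x i)) ^ 2 else 0) ≤ C ∧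
      ∑ i ∈ Finset.range n, (if thr r x i < x i then
      (weight r C x i * Real.exp (thr r x i)) ^ 2 else 0) ≤
      ∑ i ∈ Finset.range n, if thr r x i < x i then cost r x i else 0 := by
    induction n with
    | zero => simpa using hC
    | succ n ih =>
      obtain ⟨h1, h2⟩ := ih
      rw [Finset.sum_range_succ, Finset.sum_range_succ, sq_weight_mul_exp]
      have h3 := cost_nonneg r x n
      split_ifs with h4 h5
      · unfold cumCost at h5
        constructor <;> linarith
      · constructor <;> linarith
      · constructor <;> linarith
  exact key.1

lemma integral_thr_indicator {t : ℝ} (ht : 0 ≤ t) :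
    ∫ s, (if t < s then Real.exp t else 0) ∂stdExp = 1 ∧
      Integrable (fun s => if t < s then Real.exp t else 0) stdExp := by
  have h : (fun s => if t < s then Real.exp t else 0) =
      (Set.Ioi t).indicator fun _ => Real.exp t := by
    funext s; simp [Set.indicator]
  rw [h]
  refine ⟨?_, (integrable_const _).indicator measurableSet_Ioi⟩
  rw [integral_indicator_const _ measurableSet_Ioi, measureReal_def, stdExp_Ioi ht,
    ENNReal.toReal_ofReal (Real.exp_pos _).le, smul_eq_mul, ← Real.exp_add]
  simp

lemma integral_compensated (C : ℝ) (n : ℕ) (x : ℕ → ℝ) :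
    ∫ s, compensated r C n x s ∂stdExp = 0 := by
  obtain ⟨h1, h2⟩ := integral_thr_indicator (thr_nonneg r x n)
  unfold compensated
  rw [integral_const_mul, integral_sub (integrable_const 1) h2, h1]
  simp

/-- The excess of the conditional second moment of `compensated` over its bound by the accepted
costs. -/
def varExcess (r : ℕ → ℕ) (C : ℝ) (n : ℕ) (x : ℕ → ℝ) (s : ℝ) : ℝ :=
  weight r C x n ^ 2 * (1 - 2 * if thr r x n < s then Real.exp (thr r x n) else 0)

lemma measurable_varExcess (r : ℕ → ℕ) (C : ℝ) (n : ℕ) :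
    Measurable (Function.uncurry (varExcess r C n)) :=
  (((measurable_weight r C n).comp measurable_fst).pow_const 2).mul
    (((measurable_thr_indicator r n).const_mul 2).const_sub 1)

lemma abs_varExcess_le {C : ℝ} (hC : 0 ≤ C) (n : ℕ) (x : ℕ → ℝ) (s : ℝ) :
    |varExcess r C n x s| ≤ 1 + 2 * √C := by
  have h1 := weight_mul_exp_le (r := r) hC x n
  have h2 := weight_nonneg (r := r) C x n
  have h3 := weight_le_one (r := r) C x n
  have h4 := Real.sqrt_nonneg C
  have h5 := mul_nonneg h2 (Real.exp_pos (thr r x n)).le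
  have h6 : weight r C x n ^ 2 ≤ 1 := pow_le_one₀ h2 h3
  have h7 : weight r C x n ^ 2 * Real.exp (thr r x n) ≤ √C := by
    rw [sq, mul_assoc]
    exact (mul_le_of_le_one_left h5 h3).trans h1
  have h8 := mul_nonneg (sq_nonneg (weight r C x n)) (Real.exp_pos (thr r x n)).le
  have h9 := sq_nonneg (weight r C x n)
  have h10 : weight r C x n ^ 2 * (1 - 2 * Real.exp (thr r x n)) =
      weight r C x n ^ 2 - 2 * (weight r C x n ^ 2 * Real.exp (thr r x n)) := by ring
  unfold varExcess
  split_ifs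
  · rw [h10, abs_le]; constructor <;> linarith
  · rw [mul_zero, sub_zero, mul_one, abs_le]; constructor <;> linarith

/-- `exp t * 1{t < s}` has mean one, so the integral is minus the squared weight. -/
lemma integral_varExcess_nonpos (C : ℝ) (n : ℕ) (x : ℕ → ℝ) :
    ∫ s, varExcess r C n x s ∂stdExp ≤ 0 := by
  obtain ⟨h3, h4⟩ := integral_thr_indicator (thr_nonneg r x n)
  unfold varExcess
  rw [integral_const_mul, integral_sub (integrable_const 1) (h4.const_mul 2),
    integral_const_mul, h3]
  have := sq_nonneg (weight r C x n)
  simp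
  linarith

variable {Ω : Type*} {mΩ : MeasurableSpace Ω} {P : Measure Ω} [IsProbabilityMeasure P]
  {X : ℕ → Ω → ℝ}

lemma integrable_accepted_cost (hX : ∀ i, Measurable (X i)) {C : ℝ} (hC : 0 ≤ C) (n : ℕ) :
    Integrable (fun ω => if thr r (fun i => X i ω) n < X n ω then
      (weight r C (fun i => X i ω) n * Real.exp (thr r (fun i => X i ω) n)) ^ 2 else 0) P := by
  have hpath : Measurable fun ω i => X i ω := measurable_pi_lambda _ hX
  have hgm : Measurable fun ω => if thr r (fun i => X i ω) n < X n ω then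
      (weight r C (fun i => X i ω) n * Real.exp (thr r (fun i => X i ω) n)) ^ 2 else 0 := by
    have h1 : Measurable fun ω => thr r (fun i => X i ω) n := (measurable_thr r n).comp hpath
    exact Measurable.ite (measurableSet_lt h1 (hX n))
      ((((measurable_weight r C n).comp hpath).mul h1.exp).pow_const 2) measurable_const
  refine Integrable.of_bound hgm.aestronglyMeasurable C (ae_of_all _ fun ω => ?_)
  have h1 := weight_mul_exp_le (r := r) hC (fun i => X i ω) n
  have h2 := mul_nonneg (weight_nonneg (r := r) C (fun i => X i ω) n)
    (Real.exp_pos (thr r (fun i => X i ω) n)).le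
  split_ifs
  · rw [Real.norm_of_nonneg (sq_nonneg _)]
    exact (pow_le_pow_left₀ h2 h1 2).trans (Real.sq_sqrt hC).le
  · simpa using hC

/-- With `a = exp t * 1{accepted}`, write `(1 - a)^2 = (1 - 2 * a) + a^2`; the first part has
negative or zero mean. Only costs at acceptances remain, and their sum is bounded pathwise. -/
lemma integral_sq_compensated_le (hX : ∀ i, Measurable (X i)) (hind : iIndepFun X P)
    (hlaw : ∀ i, HasLaw (X i) stdExp P) {C : ℝ} (hC : 0 ≤ C) (n : ℕ) :
    ∫ ω, compensated r C n (fun i => X i ω) (X n ω) ^ 2 ∂P ≤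
      ∫ ω, (if thr r (fun i => X i ω) n < X n ω then
        (weight r C (fun i => X i ω) n * Real.exp (thr r (fun i => X i ω) n)) ^ 2 else 0) ∂P := by
  have hpath : Measurable fun ω i => X i ω := measurable_pi_lambda _ hX
  have hφ := measurable_varExcess r C n
  have hb := abs_varExcess_le (r := r) hC n
  have hle : ∫ ω, varExcess r C n (fun i => X i ω) (X n ω) ∂P ≤ 0 := by
    have h1 : ∀ x s, varExcess r C n (trunc n x) s = varExcess r C n x s := fun x s => by
      unfold varExcess; rw [weight_trunc, thr_trunc]
    have h2 := integral_past hX hind (hlaw n) hφ hb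
    simp only [h1] at h2
    rw [h2]
    exact integral_nonpos fun ω => integral_varExcess_nonpos C n _
  have hφi : Integrable (fun ω => varExcess r C n (fun i => X i ω) (X n ω)) P :=
    Integrable.of_bound (hφ.comp (hpath.prodMk (hX n))).aestronglyMeasurable _
      (ae_of_all _ fun ω => hb _ _)
  have hgi := integrable_accepted_cost (P := P) (r := r) hX hC n
  have hsplit : ∀ ω, compensated r C n (fun i => X i ω) (X n ω) ^ 2 =
      varExcess r C n (fun i => X i ω) (X n ω) + (if thr r (fun i => X i ω) n < X n ω then
        (weight r C (fun i => X i ω) n * Real.exp (thr r (fun i => X i ω) n)) ^ 2 else 0) := by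
    intro ω
    unfold compensated varExcess
    split_ifs <;> ring
  simp_rw [hsplit]
  rw [integral_add hφi hgi]
  linarith

lemma memLp_compensated (hX : ∀ i, Measurable (X i)) {C : ℝ} (hC : 0 ≤ C) (n : ℕ)
    (p : ENNReal) : MemLp (fun ω => compensated r C n (fun i => X i ω) (X n ω)) p P :=
  MemLp.of_bound ((measurable_compensated r C n).comp
    ((measurable_pi_lambda _ hX).prodMk (hX n))).aestronglyMeasurable (1 + √C)
    (ae_of_all _ fun _ => abs_compensated_le hC _ _ _)

/-- The indicator of a past event factors out of the integral over the next value, which vanishes.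
-/
lemma setIntegral_compensated (hX : ∀ i, Measurable (X i)) (hind : iIndepFun X P)
    (hlaw : ∀ i, HasLaw (X i) stdExp P) {C : ℝ} (hC : 0 ≤ C) (n : ℕ) {B : Set (ℕ → ℝ)}
    (hB : MeasurableSet B) :
    ∫ ω in (fun ω => trunc n fun i => X i ω) ⁻¹' B,
      compensated r C n (fun i => X i ω) (X n ω) ∂P = 0 := by
  have hpath : Measurable fun ω i => X i ω := measurable_pi_lambda _ hX
  have hU : Measurable fun ω => trunc n fun i => X i ω := (measurable_trunc n).comp hpath
  have h1 := integral_past hX hind (hlaw n)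
    (φ := fun x s => B.indicator 1 x * compensated r C n x s) (C := 1 + √C)
    (((measurable_one.indicator hB).comp measurable_fst).mul (measurable_compensated r C n))
    (fun x s => by
      rw [abs_mul]
      by_cases h : x ∈ B
      · rw [Set.indicator_of_mem h]; simpa using abs_compensated_le hC n x s
      · rw [Set.indicator_of_notMem h]
        simp
        positivity)
  simp only [integral_const_mul, integral_compensated, mul_zero, integral_zero,
    compensated_trunc] at h1
  rw [← integral_indicator (hU hB)]
  rw [← h1]
  refine integral_congr_ae (ae_of_all _ fun ω => ?_)
  beta_reduce
  by_cases h : (trunc n fun i => X i ω) ∈ B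
  · rw [Set.indicator_of_mem (s := (fun ω => trunc n fun i => X i ω) ⁻¹' B) h,
      Set.indicator_of_mem h, Pi.one_apply, one_mul]
  · rw [Set.indicator_of_notMem (s := (fun ω => trunc n fun i => X i ω) ⁻¹' B) h,
      Set.indicator_of_notMem h, zero_mul]

lemma condExp_compensated (hX : ∀ i, Measurable (X i)) (hind : iIndepFun X P)
    (hlaw : ∀ i, HasLaw (X i) stdExp P) {C : ℝ} (hC : 0 ≤ C) (n : ℕ) :
    P[fun ω => compensated r C n (fun i => X i ω) (X n ω) | past X hX n] =ᵐ[P] 0 := by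
  have hint := memLp_one_iff_integrable.1 (memLp_compensated (P := P) (r := r) hX hC n 1)
  refine (ae_eq_condExp_of_forall_setIntegral_eq ((past X hX).le n) hint
    (fun _ _ _ => integrableOn_zero) ?_ aestronglyMeasurable_zero).symm
  rintro A ⟨B, hB, rfl⟩ -
  rw [setIntegral_compensated hX hind hlaw hC n hB]
  simp

lemma ae_tendsto_sum_compensated (hX : ∀ i, Measurable (X i)) (hind : iIndepFun X P)
    (hlaw : ∀ i, HasLaw (X i) stdExp P) {C : ℝ} (hC : 0 ≤ C) :
    ∀ᵐ ω ∂P, ∃ l, Tendsto (fun n => ∑ k ∈ Finset.range n,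
      compensated r C k (fun i => X i ω) (X k ω)) atTop (𝓝 l) := by
  refine ae_exists_tendsto_sum_of_martingale_diff (past X hX) (C := C) (fun n => ?_)
    (fun n => memLp_compensated hX hC n 2) (fun n => ?_) (fun n => ?_)
  · have h1 : (fun ω => compensated r C n (fun i => X i ω) (X n ω)) = fun ω =>
        Function.uncurry (compensated r C n) (trunc n fun i => X i ω, X n ω) := by
      funext ω; exact (compensated_trunc C n _ _).symm
    rw [h1]
    refine (measurable_compensated r C n).comp (Measurable.prodMk ?_ (measurable_past_self hX n))
    exact (measurable_past_trunc hX n).mono ((past X hX).mono n.le_succ) le_rfl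
  · exact condExp_compensated hX hind hlaw hC n
  · calc ∑ k ∈ Finset.range n, ∫ ω, compensated r C k (fun i => X i ω) (X k ω) ^ 2 ∂P
        ≤ ∑ k ∈ Finset.range n, ∫ ω, (if thr r (fun i => X i ω) k < X k ω then
          (weight r C (fun i => X i ω) k * Real.exp (thr r (fun i => X i ω) k)) ^ 2 else 0) ∂P :=
          Finset.sum_le_sum fun k _ => integral_sq_compensated_le hX hind hlaw hC k
      _ = ∫ ω, ∑ k ∈ Finset.range n, (if thr r (fun i => X i ω) k < X k ω then
          (weight r C (fun i => X i ω) k * Real.exp (thr r (fun i => X i ω) k)) ^ 2 else 0) ∂P := by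
          exact (integral_finsetSum _ fun k _ => integrable_accepted_cost hX hC k).symm
      _ ≤ ∫ _, C ∂P := by
          refine integral_mono_of_nonneg (ae_of_all _ fun ω => ?_) (integrable_const C)
            (ae_of_all _ fun ω => sum_accepted_cost_le hC _ n)
          exact Finset.sum_nonneg fun k _ => by split_ifs; exacts [sq_nonneg _, le_rfl]
      _ = C := by simp

end Compensation

/-! ### The pathwise limit theorem. -/

section Limit

variable {r : ℕ → ℕ} {x : ℕ → ℝ}

/-- Along a path on which the thresholds and the compensated series converge, the number of
acceptances has the asserted growth. -/
lemma tendsto_lam_div (hr : IsRankFunction r)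
    (hlarge : Summable (fun m : ℕ => 1 / (r m : ℝ) ^ 2))
    (hM : Tendsto (numHired r x) atTop atTop) {z : ℝ}
    (hz : Tendsto (fun m => Y r x m - y r m) atTop (𝓝 z))
    (hcomp : ∀ C : ℕ, ∃ l, Tendsto (fun n => ∑ k ∈ Finset.range n,
      compensated r C k x (x k)) atTop (𝓝 l)) :
    Tendsto (fun n : ℕ => lam r (numHired r x n) / (n : ℝ)) atTop (𝓝 (Real.exp (-z))) := by
  have hlam : ∀ k, 0 < lam r (k + 1) := fun k => zero_lt_one.trans_le (one_le_lam_succ k)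
  set c : ℕ → ℝ := fun m => (Real.exp (Y r x m) / lam r (m + 1)) ^ 2 with hc
  have hc0 : ∀ m, 0 ≤ c m := fun m => sq_nonneg _
  have hcost : ∀ n, cost r x n = c (numHired r x n) := fun n => by
    rw [cost, hc, ← Y_numHired hM]
  have hsummable : Summable c := by
    obtain ⟨A, hA⟩ := hz.bddAbove_range
    refine Summable.of_nonneg_of_le hc0 (fun m => ?_)
      ((summable_sq_ratio hr hlarge).mul_left (Real.exp A ^ 2))
    have h1 : Y r x m - y r m ≤ A := hA ⟨m, rfl⟩
    have h2 : Real.exp (Y r x m) = Real.exp (Y r x m - y r m) * Real.exp (y r m) := by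
      rw [← Real.exp_add]; ring_nf
    have h3 : c m = Real.exp (Y r x m - y r m) ^ 2 *
        (Real.exp (y r m) / lam r (m + 1)) ^ 2 := by
      rw [hc, ← mul_pow, ← mul_div_assoc, ← h2]
    rw [h3]
    exact mul_le_mul_of_nonneg_right
      (pow_le_pow_left₀ (Real.exp_pos _).le (Real.exp_le_exp.2 h1) 2) (sq_nonneg _)
  have hcum : ∀ n, cumCost r x n ≤ ∑' m, c m := by
    intro n
    have h1 : cumCost r x n = ∑ m ∈ Finset.range (numHired r x n + 1), c m := by
      rw [cumCost, Finset.sum_range_succ, hcost]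
      congr 1
      exact sum_hired hM (fun m t => (Real.exp t / lam r (m + 1)) ^ 2) n
    rw [h1]
    exact hsummable.sum_le_tsum _ fun i _ => hc0 i
  -- At this level the truncation never acts on the path. A natural number is chosen because almost
  -- sure convergence can be had for countably many levels at once.
  obtain ⟨C, hC⟩ := exists_nat_ge (∑' m, c m)
  obtain ⟨l, hl⟩ := hcomp C
  set b : ℕ → ℝ := fun n => lam r (numHired r x n + 1) with hb
  have hb0 : ∀ n, 0 < b n := fun n => hlam _
  have hbmono : Monotone b := fun m n h => lam_mono (by have := numHired_mono r x h; omega)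
  have hbtop : Tendsto b atTop atTop :=
    tendsto_lam.comp ((tendsto_add_atTop_nat 1).comp hM)
  have hkron := tendsto_sum_div_of_tendsto_sum hbmono hbtop hl
  have hbξ : ∀ n, ∑ i ∈ Finset.range n, b i * compensated r C i x (x i) =
      n - ∑ m ∈ Finset.range (numHired r x n), Real.exp (Y r x m) := by
    intro n
    rw [← sum_hired hM (fun _ t => Real.exp t) n]
    have h1 : ∀ i, b i * compensated r C i x (x i) =
        1 - if thr r x i < x i then Real.exp (thr r x i) else 0 := by
      intro i
      rw [compensated, weight, if_pos ((hcum i).trans hC), ← mul_assoc,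
        mul_inv_cancel₀ (hb0 i).ne', one_mul]
    simp_rw [h1]
    rw [Finset.sum_sub_distrib]
    simp
  simp_rw [hbξ] at hkron
  have hS : Tendsto (fun m => (∑ k ∈ Finset.range m, Real.exp (Y r x k)) / lam r m) atTop
      (𝓝 (Real.exp z)) := by
    have h1 := tendsto_weighted_average (a := fun m => Real.exp (Y r x m - y r m))
      (g := fun m => Real.exp (y r m)) (fun i => (Real.exp_pos _).le) tendsto_lam
      ((Real.continuous_exp.tendsto z).comp hz)
    refine h1.congr fun m => ?_
    simp_rw [← Real.exp_add, sub_add_cancel]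
    rfl
  have hratio := (tendsto_lam_div_lam_succ hr hlarge).comp hM
  have hlim : Tendsto (fun n : ℕ => (n : ℝ) / lam r (numHired r x n)) atTop
      (𝓝 (Real.exp z)) := by
    -- With `S` the sum of `exp(Y_m)` over `m < M_n`, split `n / λ_{M_n}` into `(n - S) / λ_{M_n}`
    -- and `S / λ_{M_n}`; the ratio of consecutive `λ` changes the denominator in Kronecker's lemma.
    have h1 := (hkron.div hratio one_ne_zero).add (hS.comp hM)
    rw [zero_div, zero_add] at h1
    refine h1.congr' ?_
    filter_upwards [hM.eventually_gt_atTop 0] with n hn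
    have h2 : 0 < lam r (numHired r x n) := by
      obtain ⟨k, hk⟩ := Nat.exists_eq_succ_of_ne_zero hn.ne'
      rw [hk]; exact hlam k
    have h3 := hb0 n
    simp only [Function.comp, Pi.div_apply]
    simp only [hb] at h3 ⊢
    field_simp
    ring
  have hinv := hlim.inv₀ (Real.exp_pos z).ne'
  rw [← Real.exp_neg] at hinv
  exact hinv.congr fun n => inv_div _ _

end Limit

end Hiring

end

/-! ### Transfer from `expSeq` to the given probability space. -/

theorem mainTheorem4 {Ω : Type*} [MeasurableSpace Ω] (P : Measure Ω) [IsProbabilityMeasure P]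
    (r : ℕ → ℕ) (hr : Hiring.IsRankFunction r)
    (hlarge : Summable (fun m : ℕ => 1 / (r m : ℝ) ^ 2))
    (X : ℕ → Ω → ℝ) (hXm : ∀ i, Measurable (X i)) (hXindep : iIndepFun X P)
    (hXlaw : ∀ i, HasLaw (X i) (expMeasure 1) P) :
    -- the variables `E_k` with `δ_k = 1` are i.i.d. with law `Exp(1)`
    (∀ k, 1 ≤ k → r k = r (k - 1) →
      HasLaw (fun ω => Hiring.E r (fun i => X i ω) k) (expMeasure 1) P) ∧
    iIndepFun (fun (k : {k : ℕ // 1 ≤ k ∧ r k = r (k - 1)}) (ω : Ω) =>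
      Hiring.E r (fun i => X i ω) k) P ∧
    -- they represent the thresholds
    (∀ᵐ ω ∂P, ∀ m, Hiring.Y r (fun i => X i ω) m =
      ∑ k ∈ Finset.Icc 1 m, Hiring.delta r k / (r k : ℝ) * Hiring.E r (fun i => X i ω) k) ∧
    -- the series `Z` converges a.s., and the limit theorem holds
    ∃ Z : Ω → ℝ, Measurable Z ∧
      (∀ᵐ ω ∂P, Tendsto (fun m : ℕ => ∑ k ∈ Finset.Icc 1 m,
        Hiring.delta r k / (r k : ℝ) * (Hiring.E r (fun i => X i ω) k - 1)) atTop (𝓝 (Z ω))) ∧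
      ∀ᵐ ω ∂P, Tendsto (fun n : ℕ =>
        Hiring.lam r (Hiring.numHired r (fun i => X i ω) n) / (n : ℝ)) atTop
          (𝓝 (Real.exp (-Z ω))) := by
  have hM := Hiring.ae_tendsto_numHired (r := r) hXm hXindep hXlaw
  have hgm := Hiring.aemeasurable_gap (r := r) hXm hXindep hXlaw
  have hgap := Hiring.map_gap (r := r) hXm hXindep hXlaw
  have hinnov_m : ∀ m, AEMeasurable
      (fun ω => Hiring.innov r (Hiring.gap r fun i => X i ω) m) P := fun m =>
    (Hiring.measurable_innov r m).comp_aemeasurable hgm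
  have hE : ∀ m, (fun ω => Hiring.innov r (Hiring.gap r fun i => X i ω) m) =ᵐ[P]
      fun ω => Hiring.E r (fun i => X i ω) (m + 1) := fun m => by
    filter_upwards [hM] with ω hω
    exact (Hiring.E_succ hr hω m).symm
  -- The gaps push `P` forward to `expSeq`, so the independence of the innovations there is pulled
  -- back along `gap`.
  have hindep : iIndepFun (fun m ω => Hiring.E r (fun i => X i ω) (m + 1)) P := by
    refine iIndepFun.congr hE ?_
    rw [iIndepFun_iff_measure_inter_preimage_eq_mul]
    intro S B hB
    have hpre : ∀ i ∈ S, MeasurableSet ((fun u => Hiring.innov r u i) ⁻¹' B i) := fun i hi =>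
      Hiring.measurable_innov r i (hB i hi)
    have h1 := (Hiring.iIndepFun_innov hr).measure_inter_preimage_eq_mul S (sets := B) hB
    rw [← hgap, Measure.map_apply_of_aemeasurable hgm
      (Finset.measurableSet_biInter S hpre)] at h1
    rw [Set.preimage_iInter₂] at h1
    refine h1.trans (Finset.prod_congr rfl fun i hi => ?_)
    rw [Measure.map_apply_of_aemeasurable hgm (hpre i hi)]
    rfl
  refine ⟨fun k hk hδ => ?_, ?_, ?_, ?_⟩
  · obtain ⟨m, rfl⟩ : ∃ m, k = m + 1 := ⟨k - 1, by omega⟩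
    rw [Nat.add_sub_cancel] at hδ
    refine ⟨(hinnov_m m).congr (hE m), ?_⟩
    rw [← Measure.map_congr (hE m)]
    have h1 := AEMeasurable.map_map_of_aemeasurable (μ := P)
      (Hiring.measurable_innov r m).aemeasurable hgm
    rw [hgap, Hiring.map_innov hr, Hiring.innovLaw, if_pos hδ] at h1
    exact h1.symm
  · have hinj : Function.Injective
        fun k : {k : ℕ // 1 ≤ k ∧ r k = r (k - 1)} => (k : ℕ) - 1 := by
      intro a b hab
      have ha := a.2.1
      have hb := b.2.1
      simp only at hab
      exact Subtype.ext (by omega)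
    have h1 := hindep.precomp hinj
    have h2 : ∀ k : {k : ℕ // 1 ≤ k ∧ r k = r (k - 1)}, (k : ℕ) - 1 + 1 = k := fun k =>
      Nat.sub_add_cancel k.2.1
    simpa only [h2] using h1
  · filter_upwards [hM] with ω hω
    exact Hiring.Y_eq_sum hr hω
  · have hconv : ∀ᵐ ω ∂P, ∃ l, Tendsto (fun n => ∑ k ∈ Finset.range n,
        Hiring.centred r k (Hiring.innov r (Hiring.gap r fun i => X i ω) k)) atTop (𝓝 l) := by
      have h := Hiring.ae_tendsto_centred hr hlarge
      rw [← hgap] at h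
      exact ae_of_ae_map hgm h
    have hcm : ∀ n, AEMeasurable (fun ω => ∑ k ∈ Finset.range n,
        Hiring.centred r k (Hiring.innov r (Hiring.gap r fun i => X i ω) k)) P := by
      intro n
      refine Finset.aemeasurable_fun_sum _ fun k _ => ?_
      unfold Hiring.centred
      exact ((hinnov_m k).sub_const 1).const_mul _
    -- The innovations are only almost everywhere measurable functions of `ω`; this selects a
    -- measurable version of the limit.
    obtain ⟨Z, hZm, hZ⟩ := measurable_limit_of_tendsto_metrizable_ae hcm hconv
    have hsum : ∀ᵐ ω ∂P, ∀ m, ∑ k ∈ Finset.range m,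
        Hiring.centred r k (Hiring.innov r (Hiring.gap r fun i => X i ω) k) =
        ∑ k ∈ Finset.Icc 1 m,
          Hiring.delta r k / (r k : ℝ) * (Hiring.E r (fun i => X i ω) k - 1) := by
      filter_upwards [hM] with ω hω m
      induction m with
      | zero => simp
      | succ m ih =>
        rw [Finset.sum_range_succ, Finset.sum_Icc_succ_top (by omega), ih,
          Hiring.E_succ hr hω, Hiring.centred]
    have hZ' : ∀ᵐ ω ∂P, Tendsto (fun m : ℕ => ∑ k ∈ Finset.Icc 1 m,
        Hiring.delta r k / (r k : ℝ) * (Hiring.E r (fun i => X i ω) k - 1)) atTop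
          (𝓝 (Z ω)) := by
      filter_upwards [hZ, hsum] with ω h1 h2
      exact h1.congr h2
    refine ⟨Z, hZm, hZ', ?_⟩
    have hcomp : ∀ᵐ ω ∂P, ∀ C : ℕ, ∃ l, Tendsto (fun n => ∑ k ∈ Finset.range n,
        Hiring.compensated r C k (fun i => X i ω) (X k ω)) atTop (𝓝 l) :=
      ae_all_iff.2 fun C =>
        Hiring.ae_tendsto_sum_compensated hXm hXindep hXlaw (Nat.cast_nonneg C)
    filter_upwards [hM, hZ', hcomp] with ω h1 h2 h3
    refine Hiring.tendsto_lam_div hr hlarge h1 (h2.congr fun m => ?_) h3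
    rw [Hiring.Y_eq_sum hr h1, Hiring.y, ← Finset.sum_sub_distrib]
    exact Finset.sum_congr rfl fun k _ => by ring
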